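/- Let $V$ be a finite-dimensional real vector space with a non-degenerate symmetric bilinear form $g$ of arbitrary signature; indices are raised and lowered with $g$. Let $Q\subset V$ be one of the standard models of constant sectional curvature: either the (pseudo-)sphere $Q=\{x: g(x,x)=1\}$ (the non-flat case) or the hyperplane $Q=\{x: g(x,u)=1\}$ with a unit normal $u$, $g(u,u)=1$ (the flat case). Let $M$ be a non-empty relatively open subset of $Q$ (for instance $M=Q$, if $Q\neq\emptyset$), with the induced metric. Put $\bar g_{ij}=g_{ij}$ in the non-flat case and $\bar g_{ij}=g_{ij}-u_iu_j$ in the flat case. Let $K$ be a smooth Killing tensor on $M$, i.e. a smooth symmetric tensor field $K_{\alpha\beta}$ with $\nabla_{(\alpha}K_{\beta\gamma)}=0$, where $\nabla$ is the Levi-Civita connection of $M$, and let $N(X,Y)=K^2[X,Y]-K[KX,Y]-K[X,KY]+[KX,KY]$ be the Nijenhuis torsion of the associated endomorphism field. An algebraic curvature tensor is a tensor $R_{a_1b_1a_2b_2}$ on $V$ that is antisymmetric in $a_1,b_1$ and in $a_2,b_2$, is invariant under exchanging these two pairs, and satisfies $R_{a_1b_1a_2b_2}+R_{a_1a_2b_2b_1}+R_{a_1b_2b_1a_2}=0$.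 A symmetrised algebraic curvature tensor is a tensor $S_{a_1a_2b_1b_2}$ on $V$ that is symmetric in $a_1,a_2$ and in $b_1,b_2$, is invariant under exchanging these two pairs, and satisfies $S_{a_1a_2b_1b_2}+S_{a_1b_2a_2b_1}+S_{a_1b_1b_2a_2}=0$. Say that $R$, respectively $S$, corresponds to $K$ if $K_x(v,w)=R_{a_1b_1a_2b_2}x^{a_1}v^{b_1}x^{a_2}w^{b_2}$, respectively $K_x(v,w)=S_{a_1a_2b_1b_2}x^{a_1}x^{a_2}v^{b_1}w^{b_2}$, for all $x\in M$ and $v,w\in T_xM$. For a set $s$ of index names let $\mathrm{Sym}_s=\sum_\pi\pi$ and $\mathrm{Alt}_s=\sum_\pi(\operatorname{sign}\pi)\,\pi$, the sums running over all permutations of $s$, acting on tensors by permuting index names; in a product the right factor acts first. Consider the four operators $$(a)\ \mathrm{Alt}_{b_2c_2d_2a_2}\mathrm{Sym}_{b_2b_1d_1},\quad(b)\ \mathrm{Alt}_{c_2d_2a_2}\mathrm{Sym}_{b_2b_1d_1},\quad(c)\ \mathrm{Alt}_{b_2c_2d_2a_2},\quad(d)\ \mathrm{Sym}_{b_2b_1d_1}\mathrm{Alt}_{b_2c_2d_2a_2}.$$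 Here (d) is the Young symmetriser of the hook tableau with first row $b_2,b_1,d_1$ and first column $b_2,c_2,d_2,a_2$, and (a) is its adjoint. If $M$ is connected, then there are a unique algebraic curvature tensor $R$ and a unique symmetrised algebraic curvature tensor $S$ corresponding to $K$. Moreover, whether or not $M$ is connected: 1. For every $S$ corresponding to $K$ and every operator $P$ among (a)-(d), the first Nijenhuis condition $N^\delta{}_{[\beta\gamma}g_{\alpha]\delta}=0$ on $M$ is equivalent to $P\,\bar g_{ij}S^i{}_{a_2b_1b_2}S^j{}_{c_2d_1d_2}=0$. 2. For every $R$ corresponding to $K$ and every operator $P$ among (a)-(d), the first Nijenhuis condition on $M$ is equivalent to $P\,\bar g_{ij}R^i{}_{b_1a_2b_2}R^j{}_{d_1c_2d_2}=0$. 3. In the non-flat case, for every $R$ corresponding to $K$, the first Nijenhuis condition on $M$ is equivalent to $\Omega\wedge\Omega=0$, where $\Omega^{a_1}{}_{b_1}=R^{a_1}{}_{b_1a_2b_2}\,dx^{a_2}\wedge dx^{b_2}\in\operatorname{End}(V)\otimes\Lambda^2V^*$ and the wedge product combines the exterior product of forms with the composition of endomorphisms. -/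

import Mathlib

set_option linter.unusedSectionVars false

open scoped ContDiff

noncomputable section

namespace KillingNijenhuis

theorem vec4_update_zero {W : Type*} (a b c d e : W) : Function.update ![a, b, c, d] 0 e = ![e, b, c, d] := by
  ext i; fin_cases i <;> rfl

theorem vec4_update_one {W : Type*} (a b c d e : W) : Function.update ![a, b, c, d] 1 e = ![a, e, c, d] := by
  ext i; fin_cases i <;> rfl

theorem vec4_update_two {W : Type*} (a b c d e : W) : Function.update ![a, b, c, d] 2 e = ![a, b, e, d] := by
  ext i; fin_cases i <;> rfl

theorem vec4_update_three {W : Type*} (a b c d e : W) : Function.update ![a, b, c, d] 3 e = ![a, b, c, e] := by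
  ext i; fin_cases i <;> rfl

variable {V : Type*} [NormedAddCommGroup V] [NormedSpace ℝ V] [FiniteDimensional ℝ V]

/-! ### The ambient inner product and the standard models -/

/-- A non-degenerate symmetric bilinear form (of arbitrary signature) on `V`. The norm of `V` only
serves as a carrier of the topology and is unrelated to this form. -/
structure InnerProd (V : Type*) [NormedAddCommGroup V] [NormedSpace ℝ V] where
  form : LinearMap.BilinForm ℝ V
  symm : form.IsSymm
  nondeg : form.Nondegenerate

/-- Raising an index: `g (g.sharp f) w = f w`. -/
def InnerProd.sharp (g : InnerProd V) (f : V →ₗ[ℝ] ℝ) : V :=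
  (g.form.toDual g.nondeg).symm f

/-- The standard models of constant sectional curvature: the (pseudo-)sphere `g(x,x) = 1` (the
non-flat case) and the hyperplane `g(x,u) = 1` with unit normal `u` (the flat case). -/
inductive Model (g : InnerProd V) : Type _
  | sphere : Model g
  | hyperplane (u : V) (hu : g.form u u = 1) : Model g

namespace Model

variable {g : InnerProd V}

def IsFlat : Model g → Prop
  | sphere => False
  | hyperplane _ _ => True

/-- The points of the model. -/
def carrier : Model g → Set V
  | sphere => {x | g.form x x = 1}
  | hyperplane u _ => {x | g.form x u = 1}

/-- The unit normal, extended from the model to all of `V`. -/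
def normal : Model g → V → V
  | sphere => fun x => x
  | hyperplane u _ => fun _ => u

/-- The tangent space of the model at one of its points, as a subspace of `V`. -/
def tangent (Q : Model g) (x : V) : Submodule ℝ V :=
  LinearMap.ker (g.form (Q.normal x))

/-- The orthogonal projection of `V` onto the tangent space at a point `x` of the model (given by
the same formula for all `x`). -/
def proj (Q : Model g) (x v : V) : V :=
  v - g.form (Q.normal x) v • Q.normal x

/-- The symmetric form `ḡ` on `V`: it equals `g` for the sphere, and `g - u ⊗ u`, the pullback of
the metric of the hyperplane by the orthogonal projection, in the flat case. -/
def gbar : Model g → V → V → ℝ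
  | sphere => fun v w => g.form v w
  | hyperplane u _ => fun v w => g.form v w - g.form u v * g.form u w

/-- The part of the model in an open set `U` of the ambient space. This is the manifold `M`. -/
def patch (Q : Model g) (U : Set V) : Set V := U ∩ Q.carrier

end Model

/-! ### Tensor fields on `M = Q.patch U`

`M` is a closed submanifold of the open set `U`, so a smooth tensor field on `M` is the restriction
to `M` of a smooth field on `U`. Fields are therefore given on `U`; every condition below depends
only on their values at points of `M` and on tangent vectors. -/

variable {g : InnerProd V}

/-- `X` represents a smooth vector field on `M`. -/
structure IsVectorField (Q : Model g) (U : Set V) (X : V → V) : Prop where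
  smooth : ContDiffOn ℝ ∞ X U
  tangent : ∀ x ∈ Q.patch U, X x ∈ Q.tangent x

/-- The Levi-Civita connection `∇_X Y` of `M`: the tangential part of the flat derivative in `V`. -/
def leviCivita (Q : Model g) (X Y : V → V) (x : V) : V :=
  Q.proj x (fderiv ℝ Y x (X x))

/-- `(∇_X K)(Y, Z) = X (K(Y, Z)) - K(∇_X Y, Z) - K(Y, ∇_X Z)`. -/
def covDeriv (Q : Model g) (K : V → V →L[ℝ] V →L[ℝ] ℝ) (X Y Z : V → V) (x : V) : ℝ :=
  fderiv ℝ (fun y => K y (Y y) (Z y)) x (X x)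
    - K x (leviCivita Q X Y x) (Z x) - K x (Y x) (leviCivita Q X Z x)

/-- `K` represents a (covariant) Killing tensor on `M`: a smooth symmetric tensor field for which
the complete symmetrisation of `∇K` vanishes. -/
structure IsKillingTensor (Q : Model g) (U : Set V) (K : V → V →L[ℝ] V →L[ℝ] ℝ) : Prop where
  smooth : ContDiffOn ℝ ∞ K U
  symm : ∀ x ∈ Q.patch U, ∀ v ∈ Q.tangent x, ∀ w ∈ Q.tangent x, K x v w = K x w v
  killing : ∀ X : Fin 3 → V → V, (∀ i, IsVectorField Q U (X i)) → ∀ x ∈ Q.patch U,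
    ∑ σ : Equiv.Perm (Fin 3), covDeriv Q K (X (σ 0)) (X (σ 1)) (X (σ 2)) x = 0

/-- The `(1,1)`-tensor field of `K`: for `x ∈ M` and `v` tangent at `x`, the vector `endo Q K x v`
is the tangent vector with `g (endo Q K x v) w = K x v w` for all tangent `w`. -/
def endo (Q : Model g) (K : V → V →L[ℝ] V →L[ℝ] ℝ) (x v : V) : V :=
  Q.proj x (g.sharp (K x v : V →ₗ[ℝ] ℝ))

/-- The Nijenhuis torsion `N(X,Y) = K²[X,Y] - K[KX,Y] - K[X,KY] + [KX,KY]`. -/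
def nijenhuis (Q : Model g) (K : V → V →L[ℝ] V →L[ℝ] ℝ) (X Y : V → V) (x : V) : V :=
  let KX : V → V := fun y => endo Q K y (X y)
  let KY : V → V := fun y => endo Q K y (Y y)
  endo Q K x (endo Q K x (VectorField.lieBracket ℝ X Y x))
    - endo Q K x (VectorField.lieBracket ℝ KX Y x)
    - endo Q K x (VectorField.lieBracket ℝ X KY x)
    + VectorField.lieBracket ℝ KX KY x

/-- The first Nijenhuis condition `N^δ_{[βγ} g_{α]δ} = 0` on `M`: the complete antisymmetrisation
of `g (N(X,Y), Z)` in `X, Y, Z` vanishes. -/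
def FirstNijenhuis (Q : Model g) (U : Set V) (K : V → V →L[ℝ] V →L[ℝ] ℝ) : Prop :=
  ∀ X : Fin 3 → V → V, (∀ i, IsVectorField Q U (X i)) → ∀ x ∈ Q.patch U,
    ∑ σ : Equiv.Perm (Fin 3), ((Equiv.Perm.sign σ : ℤ) : ℝ) *
      g.form (nijenhuis Q K (X (σ 0)) (X (σ 1)) x) (X (σ 2) x) = 0

/-! ### Algebraic curvature tensors -/

/-- Covariant tensors of valence four on `V`. -/
abbrev Tensor4 (V : Type*) [NormedAddCommGroup V] [NormedSpace ℝ V] : Type _ :=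
  MultilinearMap ℝ (fun _ : Fin 4 => V) ℝ

/-- Algebraic curvature tensors `R_{a₁ b₁ a₂ b₂}`. -/
structure IsCurvature (R : Tensor4 V) : Prop where
  antisymm_left : ∀ a₁ b₁ a₂ b₂, R ![b₁, a₁, a₂, b₂] = -R ![a₁, b₁, a₂, b₂]
  antisymm_right : ∀ a₁ b₁ a₂ b₂, R ![a₁, b₁, b₂, a₂] = -R ![a₁, b₁, a₂, b₂]
  pair : ∀ a₁ b₁ a₂ b₂, R ![a₂, b₂, a₁, b₁] = R ![a₁, b₁, a₂, b₂]
  bianchi : ∀ a₁ b₁ a₂ b₂,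
    R ![a₁, b₁, a₂, b₂] + R ![a₁, a₂, b₂, b₁] + R ![a₁, b₂, b₁, a₂] = 0

/-- Symmetrised algebraic curvature tensors `S_{a₁ a₂ b₁ b₂}`. -/
structure IsSymCurvature (S : Tensor4 V) : Prop where
  symm_left : ∀ a₁ a₂ b₁ b₂, S ![a₂, a₁, b₁, b₂] = S ![a₁, a₂, b₁, b₂]
  symm_right : ∀ a₁ a₂ b₁ b₂, S ![a₁, a₂, b₂, b₁] = S ![a₁, a₂, b₁, b₂]
  pair : ∀ a₁ a₂ b₁ b₂, S ![b₁, b₂, a₁, a₂] = S ![a₁, a₂, b₁, b₂]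
  bianchi : ∀ a₁ a₂ b₁ b₂,
    S ![a₁, a₂, b₁, b₂] + S ![a₁, b₂, a₂, b₁] + S ![a₁, b₁, b₂, a₂] = 0

/-- `R` is the algebraic curvature tensor corresponding to `K`: `K_x(v,w) = R(x,v,x,w)`. -/
def CorrespondsR (Q : Model g) (U : Set V) (K : V → V →L[ℝ] V →L[ℝ] ℝ) (R : Tensor4 V) : Prop :=
  IsCurvature R ∧
    ∀ x ∈ Q.patch U, ∀ v ∈ Q.tangent x, ∀ w ∈ Q.tangent x, K x v w = R ![x, v, x, w]

/-- `S` is the symmetrised algebraic curvature tensor corresponding to `K`: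
`K_x(v,w) = S(x,x,v,w)`. -/
def CorrespondsS (Q : Model g) (U : Set V) (K : V → V →L[ℝ] V →L[ℝ] ℝ) (S : Tensor4 V) : Prop :=
  IsSymCurvature S ∧
    ∀ x ∈ Q.patch U, ∀ v ∈ Q.tangent x, ∀ w ∈ Q.tangent x, K x v w = S ![x, x, v, w]

/-- The linear form `e ↦ T(e, a, b, c)`. -/
def slot (T : Tensor4 V) (a b c : V) : V →ₗ[ℝ] ℝ where
  toFun e := T ![e, a, b, c]
  map_add' x y := by
    have h := T.map_update_add ![0, a, b, c] 0 x y
    simp only [vec4_update_zero] at h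
    exact h
  map_smul' r x := by
    have h := T.map_update_smul ![0, a, b, c] 0 r x
    simp only [vec4_update_zero] at h
    exact h

theorem slot_add_one (T : Tensor4 V) (a a' b c : V) :
    slot T (a + a') b c = slot T a b c + slot T a' b c := by
  ext e
  have h := T.map_update_add ![e, 0, b, c] 1 a a'
  simp only [vec4_update_one] at h
  exact h

theorem slot_add_two (T : Tensor4 V) (a b b' c : V) :
    slot T a (b + b') c = slot T a b c + slot T a b' c := by
  ext e
  have h := T.map_update_add ![e, a, 0, c] 2 b b'
  simp only [vec4_update_two] at h
  exact h

theorem slot_add_three (T : Tensor4 V) (a b c c' : V) :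
    slot T a b (c + c') = slot T a b c + slot T a b c' := by
  ext e
  have h := T.map_update_add ![e, a, b, 0] 3 c c'
  simp only [vec4_update_three] at h
  exact h

theorem slot_smul_one (T : Tensor4 V) (r : ℝ) (a b c : V) :
    slot T (r • a) b c = r • slot T a b c := by
  ext e
  have h := T.map_update_smul ![e, 0, b, c] 1 r a
  simp only [vec4_update_one] at h
  exact h

theorem slot_smul_two (T : Tensor4 V) (r : ℝ) (a b c : V) :
    slot T a (r • b) c = r • slot T a b c := by
  ext e
  have h := T.map_update_smul ![e, a, 0, c] 2 r b
  simp only [vec4_update_two] at h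
  exact h

theorem slot_smul_three (T : Tensor4 V) (r : ℝ) (a b c : V) :
    slot T a b (r • c) = r • slot T a b c := by
  ext e
  have h := T.map_update_smul ![e, a, b, 0] 3 r c
  simp only [vec4_update_three] at h
  exact h

/-- The first index raised: `raise g T a b c` is the vector `T^i_{abc}`, that is,
`g (raise g T a b c) e = T(e, a, b, c)`. -/
def raise (g : InnerProd V) (T : Tensor4 V) (a b c : V) : V :=
  g.sharp (slot T a b c)

/-! ### Young symmetry operators -/

/-- The six index names of the quadratic expressions. -/
inductive Idx
  | a2 | b1 | b2 | c2 | d1 | d2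
  deriving DecidableEq

instance : Fintype Idx where
  elems := {.a2, .b1, .b2, .c2, .d1, .d2}
  complete l := by cases l <;> decide

/-- Covariant tensors of valence six whose arguments are labelled by index names. The value at
`v` is the full contraction of the index named `l` with the vector `v l`, for all names `l`. -/
abbrev Tensor6 (V : Type*) : Type _ := (Idx → V) → ℝ

/-- The tensor `ḡ_{ij} S^i_{a₂ b₁ b₂} S^j_{c₂ d₁ d₂}`. -/
def quadS (Q : Model g) (S : Tensor4 V) : Tensor6 V := fun v =>
  Q.gbar (raise g S (v .a2) (v .b1) (v .b2)) (raise g S (v .c2) (v .d1) (v .d2))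

/-- The tensor `ḡ_{ij} R^i_{b₁ a₂ b₂} R^j_{d₁ c₂ d₂}`. -/
def quadR (Q : Model g) (R : Tensor4 V) : Tensor6 V := fun v =>
  Q.gbar (raise g R (v .b1) (v .a2) (v .b2)) (raise g R (v .d1) (v .c2) (v .d2))

/-- The group algebra of the symmetric group on the index names. -/
abbrev SymAlg : Type := MonoidAlgebra ℝ (Equiv.Perm Idx)

/-- The linear action of the group algebra on tensors; a permutation `π` replaces each index name
`l` by `π l`. -/
def act (P : SymAlg) (T : Tensor6 V) : Tensor6 V := fun v =>
  ∑ π : Equiv.Perm Idx, P.coeff π * T (fun l => v (π l))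

/-- The permutations of the names in `s`. -/
def permsOf (s : Finset Idx) : Finset (Equiv.Perm Idx) :=
  Finset.univ.filter fun π => ∀ l, l ∉ s → π l = l

/-- Complete symmetrisation in the names in `s`. -/
def symOp (s : Finset Idx) : SymAlg :=
  ∑ π ∈ permsOf s, MonoidAlgebra.single π (1 : ℝ)

/-- Complete antisymmetrisation in the names in `s`. -/
def asymOp (s : Finset Idx) : SymAlg :=
  ∑ π ∈ permsOf s, MonoidAlgebra.single π ((Equiv.Perm.sign π : ℤ) : ℝ)

/-- The Young symmetriser of a tableau with the given rows and columns. -/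
def youngSymmetriser (rows cols : List (Finset Idx)) : SymAlg :=
  (rows.map symOp).prod * (cols.map asymOp).prod

/-- The adjoint in the group algebra: the linear extension of `π ↦ π⁻¹`. -/
def adjoint (P : SymAlg) : SymAlg :=
  MonoidAlgebra.mapDomain (fun π => π⁻¹) P

/-- The Young symmetriser of the hook tableau with first row `b₂ b₁ d₁` and first column
`b₂ c₂ d₂ a₂`. -/
def hook : SymAlg :=
  youngSymmetriser [{.b2, .b1, .d1}, {.c2}, {.d2}, {.a2}]
    [{.b2, .c2, .d2, .a2}, {.b1}, {.d1}]

/-- The four symmetry operators: (a) the adjoint of the hook symmetriser; (b) symmetrisation in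
`b₂, b₁, d₁` and antisymmetrisation in `c₂, d₂, a₂`; (c) antisymmetrisation in `b₂, c₂, d₂, a₂`;
(d) the hook symmetriser. -/
def symmetryOp : Fin 4 → SymAlg :=
  ![adjoint hook,
    asymOp {.c2, .d2, .a2} * symOp {.b2, .b1, .d1},
    asymOp {.b2, .c2, .d2, .a2},
    hook]

/-! ### The curvature form -/

/-- The endomorphism `R^a_{bcd} v^c w^d`, with row index `a` and column index `b`. -/
def curvEnd (g : InnerProd V) (R : Tensor4 V) (v w : V) : Module.End ℝ V where
  toFun y := raise g R y v w
  map_add' y z := by simp [raise, InnerProd.sharp, slot_add_one]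
  map_smul' c y := by simp [raise, InnerProd.sharp, slot_smul_one]

/-- The `End V`-valued two-form `Ω^{a₁}_{b₁} = R^{a₁}_{b₁ a₂ b₂} dx^{a₂} ∧ dx^{b₂}`, where
`(dx^a ∧ dx^b)(v,w) = v^a w^b - w^a v^b`. -/
def curvatureForm (g : InnerProd V) (R : Tensor4 V) : V [⋀^Fin 2]→ₗ[ℝ] Module.End ℝ V where
  toFun m := curvEnd g R (m 0) (m 1) - curvEnd g R (m 1) (m 0)
  map_update_add' m i x y := by
    ext z
    fin_cases i <;>
      simp [curvEnd, raise, InnerProd.sharp, slot_add_two, slot_add_three] <;> abel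
  map_update_smul' m i c x := by
    ext z
    fin_cases i <;>
      simp [curvEnd, raise, InnerProd.sharp, slot_smul_two, slot_smul_three, smul_sub]
  map_eq_zero_of_eq' m i j h hij := by
    fin_cases i <;> fin_cases j <;> simp_all

/-- The wedge product of `End V`-valued forms: exterior product of forms and composition of
endomorphisms. -/
def wedge (α β : V [⋀^Fin 2]→ₗ[ℝ] Module.End ℝ V) :
    V [⋀^Fin 2 ⊕ Fin 2]→ₗ[ℝ] Module.End ℝ V :=
  (LinearMap.mul' ℝ (Module.End ℝ V)).compAlternatingMap (α.domCoprod β)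

end KillingNijenhuis

end

open KillingNijenhuis

set_option linter.unusedSectionVars false

open scoped ContDiff

noncomputable section

namespace KillingNijenhuis

variable {V : Type*} [NormedAddCommGroup V] [NormedSpace ℝ V] [FiniteDimensional ℝ V]

/-! ### The action of the group algebra -/

section GroupAlgebra

variable {W : Type*}

/-! Everything is compared with one cubic form. Let T be R with its first index raised and let
c(x;p,q,r) be the cyclic sum over p, q, r of ḡ(T(x,p,x), T(x,q,r)) (`curvCubic`). The first
Nijenhuis condition and each algebraic condition turn out to say that c vanishes identically.

Analytic side: differentiating KX = proj T(x,X,x) along M, all derivatives of the vector fields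
cancel in N. Bianchi and pair symmetry then turn the alternation of g(N(X,Y),Z) into 6c(x;X,Y,Z)
(`CorrespondsR.sum_form_nijenhuis`). Since c vanishes for p = x and is homogeneous in x, its
vanishing on tangent vectors of M spreads to all vectors, then to the open cone over M, then to all
of V (`CorrespondsR.firstNijenhuis_iff`).

Algebraic side: a tensor symmetric in b₂, b₁, d₁ is determined by its values at b₂ = b₁ = d₁ = x,
and there (b) and (d) give nonzero multiples of c. For (a) the additional alternation loses nothing
because c(x;x,q,r) = 0; for (c) the possible extra component is excluded by the Bianchi identity
(`act_asym_four_curvQuad_eq_zero`). The tensor S is treated through its curvature tensor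
`toCurvature S`, which only changes the constants. On the sphere Ω∧Ω is, up to sign, operator (c)
applied to the quadratic expression in R.

Existence of S: K extends to the cone over M as a Killing tensor of the flat space V, homogeneous of
degree two (`IsKillingTensor.dirDeriv_coneExtension`). Third derivatives of a flat Killing 2-tensor
vanish, so on the connected cone the extension is half its constant second derivative
(`exists_symCurvature_of_killing`). Uniqueness is polarisation on the open cone together with
Bianchi. -/

theorem act_zero (T : Tensor6 W) : act 0 T = 0 := by
  funext v; simp [act]

theorem act_add (P P' : SymAlg) (T : Tensor6 W) : act (P + P') T = act P T + act P' T := by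
  funext v; simp [act, add_mul, Finset.sum_add_distrib]

theorem act_single (π : Equiv.Perm Idx) (c : ℝ) (T : Tensor6 W) :
    act (MonoidAlgebra.single π c) T = fun v => c * T (fun l => v (π l)) := by
  funext v
  simp only [act, MonoidAlgebra.coeff_single]
  rw [Finset.sum_eq_single π] <;> simp +contextual [eq_comm]

theorem act_finsetSum {ι : Type*} (s : Finset ι) (f : ι → SymAlg) (T : Tensor6 W) :
    act (∑ i ∈ s, f i) T = ∑ i ∈ s, act (f i) T := by
  classical
  induction s using Finset.induction_on with
  | empty => simp [act_zero]
  | insert a s ha ih => simp [Finset.sum_insert ha, act_add, ih]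

theorem act_tensor_zero (P : SymAlg) : act P (0 : Tensor6 W) = 0 := by
  funext v; simp [act]

theorem act_tensor_add (P : SymAlg) (T T' : Tensor6 W) : act P (T + T') = act P T + act P T' := by
  funext v; simp [act, mul_add, Finset.sum_add_distrib]

theorem act_tensor_smul (P : SymAlg) (c : ℝ) (T : Tensor6 W) : act P (c • T) = c • act P T := by
  funext v
  simp only [act, Pi.smul_apply, smul_eq_mul, Finset.mul_sum]
  exact Finset.sum_congr rfl fun _ _ => by ring

theorem act_single_mul (π : Equiv.Perm Idx) (c : ℝ) (P : SymAlg) (T : Tensor6 W) :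
    act (MonoidAlgebra.single π c * P) T = act (MonoidAlgebra.single π c) (act P T) := by
  induction P using MonoidAlgebra.induction_linear with
  | zero => simp [act_zero, act_tensor_zero]
  | add P P' h h' => rw [mul_add, act_add, h, h', act_add, act_tensor_add]
  | single σ d =>
    rw [MonoidAlgebra.single_mul_single]
    simp only [act_single]
    funext v
    simp [mul_assoc]

theorem act_mul (P P' : SymAlg) (T : Tensor6 W) : act (P * P') T = act P (act P' T) := by
  induction P using MonoidAlgebra.induction_linear with
  | zero => simp [act_zero]
  | add P Q h h' => rw [add_mul, act_add, h, h', act_add]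
  | single π c => exact act_single_mul π c P' T

theorem act_one (T : Tensor6 W) : act 1 T = T := by
  rw [MonoidAlgebra.one_def, act_single]
  funext v; simp

theorem mem_permsOf {s : Finset Idx} {π : Equiv.Perm Idx} :
    π ∈ permsOf s ↔ ∀ l, l ∉ s → π l = l := by
  simp [permsOf]

theorem mul_mem_permsOf {s : Finset Idx} {π σ : Equiv.Perm Idx} (hπ : π ∈ permsOf s)
    (hσ : σ ∈ permsOf s) : π * σ ∈ permsOf s := by
  rw [mem_permsOf] at *
  intro l hl
  rw [Equiv.Perm.mul_apply, hσ l hl, hπ l hl]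

theorem inv_mem_permsOf {s : Finset Idx} {π : Equiv.Perm Idx} (hπ : π ∈ permsOf s) :
    π⁻¹ ∈ permsOf s := by
  rw [mem_permsOf] at *
  intro l hl
  rw [Equiv.Perm.inv_eq_iff_eq, hπ l hl]

theorem permsOf_singleton (a : Idx) : permsOf {a} = {1} := by
  ext π
  simp only [mem_permsOf, Finset.mem_singleton]
  refine ⟨fun h => ?_, fun h => by simp [h]⟩
  ext l
  by_cases hl : l = a
  · subst hl
    by_contra hne
    exact hne (π.injective (h _ hne))
  · simpa using h l hl

/-- Coset decomposition by the image b of a. It lets the operators be expanded one name at a time,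
without enumerating the 720 permutations of the index names. -/
theorem sum_permsOf_insert {M : Type*} [AddCommMonoid M] {a : Idx} {s : Finset Idx} (h : a ∉ s)
    (f : Equiv.Perm Idx → M) :
    ∑ π ∈ permsOf (insert a s), f π
      = ∑ b ∈ insert a s, ∑ σ ∈ permsOf s, f (Equiv.swap a b * σ) := by
  rw [← Finset.sum_product']
  symm
  refine Finset.sum_bij' (fun p _ => Equiv.swap a p.1 * p.2)
    (fun π _ => (π a, Equiv.swap a (π a) * π)) ?_ ?_ ?_ ?_ ?_
  · rintro ⟨b, σ⟩ hp
    obtain ⟨hb, hσ⟩ := Finset.mem_product.1 hp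
    simp only at hb hσ
    rw [mem_permsOf] at *
    intro l hl
    have hla : l ≠ a := fun e => hl (by simp [e])
    have hlb : l ≠ b := fun e => hl (by simpa [e] using hb)
    simp only [Finset.mem_insert, not_or] at hl
    rw [Equiv.Perm.mul_apply, hσ l hl.2, Equiv.swap_apply_of_ne_of_ne hla hlb]
  · intro π hπ
    rw [mem_permsOf] at hπ
    have ha : π a ∈ insert a s := by
      by_contra hc
      have := π.injective (hπ _ hc)
      simp [this] at hc
    refine Finset.mem_product.2 ⟨ha, ?_⟩
    rw [mem_permsOf]
    intro l hl
    by_cases hla : l = a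
    · simp [hla]
    · have hl' : π l = l := hπ l (by simp [hla, hl])
      have hlb : l ≠ π a := fun e => hla (π.injective (hl'.trans e))
      rw [Equiv.Perm.mul_apply, hl', Equiv.swap_apply_of_ne_of_ne hla hlb]
  · rintro ⟨b, σ⟩ hp
    obtain ⟨-, hσ⟩ := Finset.mem_product.1 hp
    have hσa : σ a = a := mem_permsOf.1 hσ a h
    simp [hσa, ← mul_assoc]
  · intro π _
    simp [← mul_assoc]
  · intros; rfl

theorem act_symOp (s : Finset Idx) (T : Tensor6 W) (v : Idx → W) :
    act (symOp s) T v = ∑ π ∈ permsOf s, T (fun l => v (π l)) := by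
  simp [symOp, act_finsetSum, act_single]

theorem act_asymOp (s : Finset Idx) (T : Tensor6 W) (v : Idx → W) :
    act (asymOp s) T v
      = ∑ π ∈ permsOf s, ((Equiv.Perm.sign π : ℤ) : ℝ) * T (fun l => v (π l)) := by
  simp [asymOp, act_finsetSum, act_single]

theorem act_symOp_insert {a : Idx} {s : Finset Idx} (h : a ∉ s) (T : Tensor6 W) (v : Idx → W) :
    act (symOp (insert a s)) T v
      = ∑ b ∈ insert a s, act (symOp s) T (fun l => v (Equiv.swap a b l)) := by
  simp only [act_symOp, sum_permsOf_insert h, Equiv.Perm.mul_apply]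

theorem act_asymOp_insert {a : Idx} {s : Finset Idx} (h : a ∉ s) (T : Tensor6 W) (v : Idx → W) :
    act (asymOp (insert a s)) T v
      = act (asymOp s) T v - ∑ b ∈ s, act (asymOp s) T (fun l => v (Equiv.swap a b l)) := by
  simp only [act_asymOp, sum_permsOf_insert h, Equiv.Perm.mul_apply, Finset.sum_insert h,
    sub_eq_add_neg, ← Finset.sum_neg_distrib]
  congr 1
  · simp
  · refine Finset.sum_congr rfl fun b hb => Finset.sum_congr rfl fun σ _ => ?_
    have hab : a ≠ b := fun e => h (e ▸ hb)
    simp [Equiv.Perm.sign_mul, Equiv.Perm.sign_swap hab]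

theorem symOp_singleton (a : Idx) : symOp {a} = 1 := by
  simp [symOp, permsOf_singleton, MonoidAlgebra.one_def]

theorem asymOp_singleton (a : Idx) : asymOp {a} = 1 := by
  simp [asymOp, permsOf_singleton, MonoidAlgebra.one_def]

theorem hook_eq : hook = symOp {.b2, .b1, .d1} * asymOp {.b2, .c2, .d2, .a2} := by
  simp [hook, youngSymmetriser, symOp_singleton, asymOp_singleton]

theorem sum_permsOf_inv {M : Type*} [AddCommMonoid M] (s : Finset Idx)
    (f : Equiv.Perm Idx → M) : ∑ π ∈ permsOf s, f π⁻¹ = ∑ π ∈ permsOf s, f π :=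
  Finset.sum_bij' (fun π _ => π⁻¹) (fun π _ => π⁻¹) (fun _ => inv_mem_permsOf)
    (fun _ => inv_mem_permsOf) (by simp) (by simp) (by simp)

theorem adjoint_finsetSum {ι : Type*} (s : Finset ι) (f : ι → SymAlg) :
    adjoint (∑ i ∈ s, f i) = ∑ i ∈ s, adjoint (f i) := by
  classical
  induction s using Finset.induction_on with
  | empty => simp [adjoint, MonoidAlgebra.mapDomain_zero]
  | insert a s ha ih =>
    rw [Finset.sum_insert ha, Finset.sum_insert ha, ← ih]
    simp [adjoint, MonoidAlgebra.mapDomain_add]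

/-- Inversion reverses the product, and each factor is its own adjoint because sign π⁻¹ = sign π. -/
theorem adjoint_hook :
    adjoint hook = asymOp {.b2, .c2, .d2, .a2} * symOp {.b2, .b1, .d1} := by
  rw [hook_eq, symOp, asymOp, Finset.sum_mul_sum, Finset.sum_mul_sum]
  simp only [MonoidAlgebra.single_mul_single, adjoint_finsetSum]
  simp only [adjoint, MonoidAlgebra.mapDomain_single, mul_inv_rev]
  rw [sum_permsOf_inv _ (fun π => ∑ x ∈ permsOf {.b2, .c2, .d2, .a2}, MonoidAlgebra.single
    (x⁻¹ * π) (1 * ((Equiv.Perm.sign x : ℤ) : ℝ))), Finset.sum_comm,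
    ← sum_permsOf_inv {.b2, .c2, .d2, .a2}]
  simp

theorem asymOp_mul_symOp_comm {s t : Finset Idx} (h : Disjoint s t) :
    asymOp s * symOp t = symOp t * asymOp s := by
  rw [symOp, asymOp, Finset.sum_mul_sum, Finset.sum_mul_sum, Finset.sum_comm]
  refine Finset.sum_congr rfl fun π hπ => Finset.sum_congr rfl fun σ hσ => ?_
  rw [MonoidAlgebra.single_mul_single, MonoidAlgebra.single_mul_single, one_mul, mul_one]
  congr 1
  refine Equiv.Perm.Disjoint.commute fun l => ?_
  by_cases hl : l ∈ s
  · exact Or.inr (mem_permsOf.1 hπ l (Finset.disjoint_left.1 h hl))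
  · exact Or.inl (mem_permsOf.1 hσ l hl)

theorem act_symOp_perm {s : Finset Idx} {σ : Equiv.Perm Idx} (hσ : σ ∈ permsOf s)
    (T : Tensor6 W) (v : Idx → W) :
    act (symOp s) T (fun l => v (σ l)) = act (symOp s) T v := by
  simp only [act_symOp]
  exact Finset.sum_bij' (fun π _ => σ * π) (fun π _ => σ⁻¹ * π)
    (fun _ h => mul_mem_permsOf hσ h) (fun _ h => mul_mem_permsOf (inv_mem_permsOf hσ) h)
    (by simp) (by simp) (by simp)

theorem act_asymOp_perm {s : Finset Idx} {σ : Equiv.Perm Idx} (hσ : σ ∈ permsOf s)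
    (T : Tensor6 W) (v : Idx → W) :
    act (asymOp s) T (fun l => v (σ l))
      = ((Equiv.Perm.sign σ : ℤ) : ℝ) * act (asymOp s) T v := by
  simp only [act_asymOp, Finset.mul_sum]
  refine Finset.sum_bij' (fun π _ => σ * π) (fun π _ => σ⁻¹ * π)
    (fun _ h => mul_mem_permsOf hσ h) (fun _ h => mul_mem_permsOf (inv_mem_permsOf hσ) h)
    (by simp) (by simp) fun π _ => ?_
  rw [Equiv.Perm.sign_mul, Units.val_mul, Int.cast_mul, ← mul_assoc, ← mul_assoc]
  rcases Int.units_eq_one_or (Equiv.Perm.sign σ) with h | h <;> simp [h]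

/-- The family of six arguments with the given values, in the order `a₂ b₁ b₂ c₂ d₁ d₂`. -/
def idxVec (a b c d e f : W) : Idx → W
  | .a2 => a
  | .b1 => b
  | .b2 => c
  | .c2 => d
  | .d1 => e
  | .d2 => f

theorem eq_idxVec (v : Idx → W) :
    v = idxVec (v .a2) (v .b1) (v .b2) (v .c2) (v .d1) (v .d2) := by
  funext l; cases l <;> rfl

theorem act_sym_three (T : Tensor6 W) (a b c d e f : W) :
    act (symOp {.b2, .b1, .d1}) T (idxVec a b c d e f)
      = T (idxVec a b c d e f) + T (idxVec a e c d b f) + (T (idxVec a c b d e f)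
        + T (idxVec a e b d c f) + (T (idxVec a b e d c f) + T (idxVec a c e d b f))) := by
  rw [act_symOp_insert (by decide), Finset.sum_insert (by decide), Finset.sum_insert (by decide),
    Finset.sum_singleton]
  simp only [act_symOp_insert (show Idx.b1 ∉ ({.d1} : Finset Idx) by decide),
    Finset.sum_insert (show Idx.b1 ∉ ({.d1} : Finset Idx) by decide), Finset.sum_singleton,
    symOp_singleton, act_one]
  congr 1
  · congr 1 <;> congr 1 <;> funext l <;> cases l <;> rfl
  · congr 1 <;> congr 1 <;> congr 1 <;> funext l <;> cases l <;> rfl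

theorem act_asym_three (T : Tensor6 W) (a b c d e f : W) :
    act (asymOp {.c2, .d2, .a2}) T (idxVec a b c d e f)
      = T (idxVec a b c d e f) - T (idxVec f b c d e a) - (T (idxVec a b c f e d)
        - T (idxVec d b c f e a) + (T (idxVec d b c a e f) - T (idxVec f b c a e d))) := by
  rw [act_asymOp_insert (by decide), Finset.sum_insert (by decide), Finset.sum_singleton]
  simp only [act_asymOp_insert (show Idx.d2 ∉ ({.a2} : Finset Idx) by decide),
    Finset.sum_singleton, asymOp_singleton, act_one]
  congr 1
  · congr 1 <;> congr 1 <;> funext l <;> cases l <;> rfl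
  · congr 1 <;> congr 1 <;> congr 1 <;> funext l <;> cases l <;> rfl

theorem act_asym_four (T : Tensor6 W) (a b c d e f : W) :
    act (asymOp {.b2, .c2, .d2, .a2}) T (idxVec a b c d e f)
      = act (asymOp {.c2, .d2, .a2}) T (idxVec a b c d e f)
        - (act (asymOp {.c2, .d2, .a2}) T (idxVec a b d c e f)
        + (act (asymOp {.c2, .d2, .a2}) T (idxVec a b f d e c)
        + act (asymOp {.c2, .d2, .a2}) T (idxVec c b a d e f))) := by
  rw [act_asymOp_insert (by decide), Finset.sum_insert (by decide), Finset.sum_insert (by decide),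
    Finset.sum_singleton]
  congr 1
  congr 1
  · congr 1; funext l; cases l <;> rfl
  · congr 1
    · congr 1; funext l; cases l <;> rfl
    · congr 1; funext l; cases l <;> rfl

end GroupAlgebra

/-! ### Polarisation -/

theorem eq_zero_of_symmetric_of_diag {W : Type*} [AddCommGroup W] (h : W → W → W → ℝ)
    (hadd : ∀ x x' y z, h (x + x') y z = h x y z + h x' y z)
    (h₁₂ : ∀ x y z, h y x z = h x y z) (h₂₃ : ∀ x y z, h x z y = h x y z)
    (hd : ∀ x, h x x x = 0) (x y z : W) : h x y z = 0 := by
  have hadd₂ : ∀ x y y' z, h x (y + y') z = h x y z + h x y' z := fun x y y' z => by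
    rw [h₁₂, hadd, h₁₂ y, h₁₂ y']
  have hadd₃ : ∀ x y z z', h x y (z + z') = h x y z + h x y z' := fun x y z z' => by
    rw [h₂₃, hadd₂, h₂₃ x z, h₂₃ x z']
  have e₁ := hd (x + y + z)
  have e₂ := hd (x + y)
  have e₃ := hd (x + z)
  have e₄ := hd (y + z)
  simp only [hadd, hadd₂, hadd₃, hd] at e₁ e₂ e₃ e₄
  have a₁ := h₂₃ x y z
  have a₂ := h₁₂ x y z
  have a₃ := h₁₂ x z y
  have a₄ := h₂₃ y x z
  have a₅ := h₂₃ z x y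
  linarith

/-- The first-order term of a quadrilinear form that vanishes on the diagonal. -/
theorem sum_eq_zero_of_diag {W : Type*} [AddCommGroup W] [Module ℝ W] (h : W → W → W → W → ℝ)
    (add₁ : ∀ x x' y z w, h (x + x') y z w = h x y z w + h x' y z w)
    (add₂ : ∀ x y y' z w, h x (y + y') z w = h x y z w + h x y' z w)
    (add₃ : ∀ x y z z' w, h x y (z + z') w = h x y z w + h x y z' w)
    (add₄ : ∀ x y z w w', h x y z (w + w') = h x y z w + h x y z w')
    (smul₁ : ∀ (r : ℝ) x y z w, h (r • x) y z w = r * h x y z w)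
    (smul₂ : ∀ (r : ℝ) x y z w, h x (r • y) z w = r * h x y z w)
    (smul₃ : ∀ (r : ℝ) x y z w, h x y (r • z) w = r * h x y z w)
    (smul₄ : ∀ (r : ℝ) x y z w, h x y z (r • w) = r * h x y z w)
    (hd : ∀ x, h x x x x = 0) (x p : W) :
    h p x x x + h x p x x + h x x p x + h x x x p = 0 := by
  -- As a polynomial in t this has only the coefficients c₁, c₂, c₃, as the pure terms vanish by
  -- `hd`. With f(t) its value, 8(f(1) − f(−1)) − (f(2) − f(−2)) = 12c₁ isolates the wanted one.
  have key : ∀ t : ℝ, h (x + t • p) (x + t • p) (x + t • p) (x + t • p) = 0 := fun t => hd _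
  have e₁ := key 1
  have e₂ := key (-1)
  have e₃ := key 2
  have e₄ := key (-2)
  simp only [add₁, add₂, add₃, add₄, smul₁, smul₂, smul₃, smul₄, hd] at e₁ e₂ e₃ e₄
  linarith

/-- Multilinearity of a tensor with labelled arguments. -/
def IsMultilin (T : Tensor6 V) : Prop :=
  ∃ M : MultilinearMap ℝ (fun _ : Idx => V) ℝ, ∀ v, M v = T v

theorem IsMultilin.act {T : Tensor6 V} (hT : IsMultilin T) (P : SymAlg) :
    IsMultilin (act P T) := by
  obtain ⟨M, hM⟩ := hT
  refine ⟨∑ π : Equiv.Perm Idx, P.coeff π • M.domDomCongr π, fun v => ?_⟩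
  simp [KillingNijenhuis.act, hM]

theorem IsMultilin.update_add {T : Tensor6 V} (hT : IsMultilin T) (v : Idx → V) (l : Idx)
    (x y : V) : T (Function.update v l (x + y))
      = T (Function.update v l x) + T (Function.update v l y) := by
  obtain ⟨M, hM⟩ := hT
  simp [← hM]

theorem IsMultilin.update_smul {T : Tensor6 V} (hT : IsMultilin T) (v : Idx → V) (l : Idx)
    (r : ℝ) (x : V) : T (Function.update v l (r • x)) = r * T (Function.update v l x) := by
  obtain ⟨M, hM⟩ := hT
  simp [← hM]

section Update

variable {W : Type*} (a b c d e f z : W)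

theorem update_idxVec_a2 :
    Function.update (idxVec a b c d e f) .a2 z = idxVec z b c d e f := by
  funext l; cases l <;> rfl

theorem update_idxVec_b1 :
    Function.update (idxVec a b c d e f) .b1 z = idxVec a z c d e f := by
  funext l; cases l <;> rfl

theorem update_idxVec_b2 :
    Function.update (idxVec a b c d e f) .b2 z = idxVec a b z d e f := by
  funext l; cases l <;> rfl

theorem update_idxVec_d1 :
    Function.update (idxVec a b c d e f) .d1 z = idxVec a b c d z f := by
  funext l; cases l <;> rfl

end Update

theorem eq_zero_of_symmetric_three {T : Tensor6 V} (hM : IsMultilin T)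
    (h₁ : ∀ a b c d e f, T (idxVec a c b d e f) = T (idxVec a b c d e f))
    (h₂ : ∀ a b c d e f, T (idxVec a b e d c f) = T (idxVec a b c d e f))
    (h : ∀ a d f x, T (idxVec a x x d x f) = 0) : T = 0 := by
  funext v
  rw [eq_idxVec v]
  refine eq_zero_of_symmetric_of_diag
    (fun x y z => T (idxVec (v .a2) x y (v .c2) z (v .d2)))
    (fun x x' y z => ?_) (fun x y z => h₁ _ _ _ _ _ _) (fun x y z => h₂ _ _ _ _ _ _)
    (fun x => h _ _ _ x) (v .b1) (v .b2) (v .d1)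
  have := hM.update_add (idxVec (v .a2) x y (v .c2) z (v .d2)) .b1 x x'
  simpa only [update_idxVec_b1] using this

theorem act_symOp_three_eq_zero {T : Tensor6 V} (hT : IsMultilin T)
    (h : ∀ a d f x, act (symOp {.b2, .b1, .d1}) T (idxVec a x x d x f) = 0) :
    act (symOp {.b2, .b1, .d1}) T = 0 := by
  refine eq_zero_of_symmetric_three (hT.act _) (fun a b c d e f => ?_) (fun a b c d e f => ?_) h
  · simp only [act_sym_three]; ring
  · simp only [act_sym_three]; ring

/-! ### Quadratic expressions in a curvature tensor -/

/-- The symmetries of a curvature tensor with its first index raised. -/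
structure IsCurvatureMap (T : V →ₗ[ℝ] V →ₗ[ℝ] V →ₗ[ℝ] V) : Prop where
  antisymm : ∀ b p q, T b q p = -T b p q
  bianchi : ∀ b p q, T b p q + T p q b + T q b p = 0

/-- The quadratic expression of a curvature tensor. -/
def curvQuad (β : LinearMap.BilinForm ℝ V) (T : V →ₗ[ℝ] V →ₗ[ℝ] V →ₗ[ℝ] V) : Tensor6 V :=
  fun v => β (T (v .b1) (v .a2) (v .b2)) (T (v .d1) (v .c2) (v .d2))

/-- The quadratic expression of the symmetrised curvature tensor. -/
def symCurvQuad (β : LinearMap.BilinForm ℝ V) (T : V →ₗ[ℝ] V →ₗ[ℝ] V →ₗ[ℝ] V) : Tensor6 V :=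
  fun v => β ((1 / 2 : ℝ) • (T (v .b1) (v .a2) (v .b2) + T (v .b2) (v .a2) (v .b1)))
    ((1 / 2 : ℝ) • (T (v .d1) (v .c2) (v .d2) + T (v .d2) (v .c2) (v .d1)))

/-- The cubic form in `x` to which the algebraic integrability conditions reduce. -/
def curvCubic (β : LinearMap.BilinForm ℝ V) (T : V →ₗ[ℝ] V →ₗ[ℝ] V →ₗ[ℝ] V) (x p q r : V) : ℝ :=
  β (T x p x) (T x q r) + β (T x q x) (T x r p) + β (T x r x) (T x p q)

section Quad

variable {β : LinearMap.BilinForm ℝ V} {T : V →ₗ[ℝ] V →ₗ[ℝ] V →ₗ[ℝ] V}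

theorem isMultilin_curvQuad : IsMultilin (curvQuad β T) := by
  refine ⟨MultilinearMap.mk' (curvQuad β T) ?_ ?_, fun _ => rfl⟩
  · intro v l x y
    cases l <;> simp [curvQuad]
  · intro v l c x
    cases l <;> simp [curvQuad]

theorem isMultilin_symCurvQuad : IsMultilin (symCurvQuad β T) := by
  refine ⟨MultilinearMap.mk' (symCurvQuad β T) ?_ ?_, fun _ => rfl⟩
  · intro v l x y
    cases l <;> simp [symCurvQuad] <;> ring
  · intro v l c x
    cases l <;> simp [symCurvQuad] <;> ring

theorem IsCurvatureMap.self (hT : IsCurvatureMap T) (b p : V) : T b p p = 0 := by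
  have := hT.antisymm b p p
  rwa [eq_neg_iff_add_eq_zero, ← two_smul ℝ, smul_eq_zero_iff_right two_ne_zero] at this

/-- One term contains T(x,x,x) = 0 and the other two cancel by antisymmetry of T. This is what makes
operator (a) lossless, and what allows tangent arguments to be replaced by arbitrary ones. -/
theorem curvCubic_self (hβ : ∀ v w, β v w = β w v) (hT : IsCurvatureMap T) (x q r : V) :
    curvCubic β T x x q r = 0 := by
  simp only [curvCubic, hT.self, map_zero, LinearMap.zero_apply, zero_add]
  rw [hT.antisymm x q x, hβ (T x q x)]
  simp

theorem act_adjoint_hook_apply (T : Tensor6 V) (a b c d e f : V) :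
    act (adjoint hook) T (idxVec a b c d e f)
      = act (asymOp {.c2, .d2, .a2} * symOp {.b2, .b1, .d1}) T (idxVec a b c d e f)
        - (act (asymOp {.c2, .d2, .a2} * symOp {.b2, .b1, .d1}) T (idxVec a b d c e f)
        + (act (asymOp {.c2, .d2, .a2} * symOp {.b2, .b1, .d1}) T (idxVec a b f d e c)
        + act (asymOp {.c2, .d2, .a2} * symOp {.b2, .b1, .d1}) T (idxVec c b a d e f))) := by
  rw [adjoint_hook, act_mul, act_asym_four]
  simp only [act_mul]

section Cubic

variable {Φ : Tensor6 V} {k : ℝ}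

theorem act_asym_sym_eq_zero_iff (hΦ : IsMultilin Φ) (hk : k ≠ 0)
    (hE : ∀ x p q r, act (asymOp {.c2, .d2, .a2} * symOp {.b2, .b1, .d1}) Φ
      (idxVec p x x q x r) = k * curvCubic β T x p q r) :
    act (asymOp {.c2, .d2, .a2} * symOp {.b2, .b1, .d1}) Φ = 0
      ↔ ∀ x p q r, curvCubic β T x p q r = 0 := by
  constructor
  · intro h x p q r
    have := hE x p q r
    rw [h] at this
    exact (mul_eq_zero.1 this.symm).resolve_left hk
  · intro h
    have hc : Disjoint ({.c2, .d2, .a2} : Finset Idx) {.b2, .b1, .d1} := by decide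
    rw [asymOp_mul_symOp_comm hc] at hE ⊢
    rw [act_mul]
    refine act_symOp_three_eq_zero (hΦ.act _) fun a d f x => ?_
    rw [← act_mul, hE, h, mul_zero]

/-- In terms of Young types, Λ³ ⊗ S³ is the hook (3,1,1,1) plus (4,1,1). The further alternation in
b₂ sees only the hook, while the component (4,1,1) is absent since the diagonal values vanish when
one alternated argument equals x. -/
theorem act_adjoint_hook_eq_zero_iff (hβ : ∀ v w, β v w = β w v) (hT : IsCurvatureMap T)
    (hΦ : IsMultilin Φ) (hk : k ≠ 0)
    (hE : ∀ x p q r, act (asymOp {.c2, .d2, .a2} * symOp {.b2, .b1, .d1}) Φ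
      (idxVec p x x q x r) = k * curvCubic β T x p q r) :
    act (adjoint hook) Φ = 0 ↔ ∀ x p q r, curvCubic β T x p q r = 0 := by
  constructor
  · intro h x p q r
    set E := act (asymOp {.c2, .d2, .a2} * symOp {.b2, .b1, .d1}) Φ with hEdef
    have hM : IsMultilin E := hΦ.act _
    -- The diagonal value with a₂ = x as well is a multiple of `curvCubic β T x x q r` = 0; this is
    -- its polarisation in the direction p.
    have pol : ∀ q r p, E (idxVec x x p q x r) + E (idxVec x p x q x r) + E (idxVec x x x q p r)
        + E (idxVec p x x q x r) = 0 := by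
      intro q r p
      refine sum_eq_zero_of_diag (fun x₁ x₂ x₃ x₄ => E (idxVec x₄ x₂ x₁ q x₃ r))
        ?_ ?_ ?_ ?_ ?_ ?_ ?_ ?_ ?_ x p
      · intro x x' y z w
        simpa only [update_idxVec_b2] using hM.update_add (idxVec w y x q z r) .b2 x x'
      · intro x y y' z w
        simpa only [update_idxVec_b1] using hM.update_add (idxVec w y x q z r) .b1 y y'
      · intro x y z z' w
        simpa only [update_idxVec_d1] using hM.update_add (idxVec w y x q z r) .d1 z z'
      · intro x y z w w'
        simpa only [update_idxVec_a2] using hM.update_add (idxVec w y x q z r) .a2 w w'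
      · intro t x y z w
        simpa only [update_idxVec_b2] using hM.update_smul (idxVec w y x q z r) .b2 t x
      · intro t x y z w
        simpa only [update_idxVec_b1] using hM.update_smul (idxVec w y x q z r) .b1 t y
      · intro t x y z w
        simpa only [update_idxVec_d1] using hM.update_smul (idxVec w y x q z r) .d1 t z
      · intro t x y z w
        simpa only [update_idxVec_a2] using hM.update_smul (idxVec w y x q z r) .a2 t w
      · intro x
        rw [hE, curvCubic_self hβ hT, mul_zero]
    have hc : Disjoint ({.c2, .d2, .a2} : Finset Idx) {.b2, .b1, .d1} := by decide
    have hs : ∀ σ ∈ permsOf ({.b2, .b1, .d1} : Finset Idx), ∀ v w, (w = fun l => v (σ l)) →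
        E w = E v := by
      rintro σ hσ v w rfl
      rw [hEdef, asymOp_mul_symOp_comm hc, act_mul, act_symOp_perm hσ]
    have ht : ∀ i ∈ ({.c2, .d2, .a2} : Finset Idx), ∀ j ∈ ({.c2, .d2, .a2} : Finset Idx), i ≠ j →
        ∀ v w, (w = fun l => v (Equiv.swap i j l)) → E w = -E v := by
      rintro i hi j hj hij v w rfl
      have hσ : Equiv.swap i j ∈ permsOf ({.c2, .d2, .a2} : Finset Idx) := by
        rw [mem_permsOf]
        intro l hl
        exact Equiv.swap_apply_of_ne_of_ne (fun e => hl (e ▸ hi)) (fun e => hl (e ▸ hj))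
      rw [hEdef, act_mul, act_asymOp_perm hσ, Equiv.Perm.sign_swap hij]
      simp
    have hs₁ : ∀ a b c d e f, E (idxVec a b c d e f) = E (idxVec a c b d e f) := by
      intro a b c d e f
      refine hs (Equiv.swap .b2 .b1) (by rw [mem_permsOf]; decide) _ _ ?_
      funext l; cases l <;> rfl
    have hs₂ : ∀ a b c d e f, E (idxVec a b c d e f) = E (idxVec a b e d c f) := by
      intro a b c d e f
      refine hs (Equiv.swap .b2 .d1) (by rw [mem_permsOf]; decide) _ _ ?_
      funext l; cases l <;> rfl
    have ht₁ : ∀ a b c d e f, E (idxVec a b c d e f) = -E (idxVec d b c a e f) := by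
      intro a b c d e f
      refine ht .c2 (by decide) .a2 (by decide) (by decide) _ _ ?_
      funext l; cases l <;> rfl
    have ht₂ : ∀ a b c d e f, E (idxVec a b c d e f) = -E (idxVec f b c d e a) := by
      intro a b c d e f
      refine ht .d2 (by decide) .a2 (by decide) (by decide) _ _ ?_
      funext l; cases l <;> rfl
    have hA := act_adjoint_hook_apply Φ p x x q x r
    rw [h, ← hEdef, ht₁ p x q x x r, ht₂ p x r q x x] at hA
    have p₁ := pol q r p
    have p₂ := pol p r q
    have p₃ := pol q p r
    rw [hs₁ x p x, hs₂ x x x q p r] at p₁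
    rw [hs₁ x q x, hs₂ x x x p q r, ht₁ q] at p₂
    rw [hs₁ x r x, hs₂ x x x q r p, ht₂ r] at p₃
    -- With e this value, each of the three swapped terms of `hA` equals −e/3 by `pol`, so `hA`
    -- reads 2e = 0.
    have h0 : E (idxVec p x x q x r) = 0 := by
      simp only [Pi.zero_apply] at hA
      linarith
    have := hE x p q r
    rw [h0] at this
    exact (mul_eq_zero.1 this.symm).resolve_left hk
  · intro h
    rw [← act_asym_sym_eq_zero_iff hΦ hk hE] at h
    funext v
    rw [eq_idxVec v, act_adjoint_hook_apply, h]
    simp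

end Cubic

end Quad

/-! ### Evaluation of the four operators on the two quadratic expressions -/

section Quad

variable {β : LinearMap.BilinForm ℝ V} {T : V →ₗ[ℝ] V →ₗ[ℝ] V →ₗ[ℝ] V}

theorem act_sym_three_diag (Φ : Tensor6 V) (a d f x : V) :
    act (symOp {.b2, .b1, .d1}) Φ (idxVec a x x d x f) = 6 * Φ (idxVec a x x d x f) := by
  rw [act_sym_three]; ring

/-- 12 = 6 · 2: the symmetrisation has six equal terms on the diagonal, and antisymmetry of T pairs
the six alternated terms into three. -/
theorem act_asym_sym_curvQuad (hT : IsCurvatureMap T) (x p q r : V) :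
    act (asymOp {.c2, .d2, .a2} * symOp {.b2, .b1, .d1}) (curvQuad β T) (idxVec p x x q x r)
      = 12 * curvCubic β T x p q r := by
  rw [act_mul, act_asym_three]
  simp only [act_sym_three_diag, curvQuad, curvCubic, idxVec]
  rw [hT.antisymm x p q, hT.antisymm x q r, hT.antisymm x r p]
  simp only [map_neg]
  ring

/-- On the diagonal the first factor is the same as for R. Alternating the second in q, r gives
(3/2)T(x,q,r) by Bianchi, in place of 2T(x,q,r); hence 12 · 3/4 = 9. -/
theorem act_asym_sym_symCurvQuad (hT : IsCurvatureMap T) (x p q r : V) :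
    act (asymOp {.c2, .d2, .a2} * symOp {.b2, .b1, .d1}) (symCurvQuad β T) (idxVec p x x q x r)
      = 9 * curvCubic β T x p q r := by
  have hS : ∀ y q r, β y (T x q r) + β y (T r q x) - (β y (T x r q) + β y (T q r x))
      = 3 * β y (T x q r) := by
    intro y q r
    have h₁ := congrArg (β y) (hT.bianchi x q r)
    rw [hT.antisymm r x q, hT.antisymm x q r]
    simp only [map_add, map_neg, map_zero] at h₁ ⊢
    linarith
  rw [act_mul, act_asym_three]
  simp only [act_sym_three_diag, symCurvQuad, curvCubic, idxVec, map_add, map_smul,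
    LinearMap.add_apply, LinearMap.smul_apply, smul_eq_mul]
  linear_combination 3 * hS (T x p x) q r + 3 * hS (T x q x) r p + 3 * hS (T x r x) p q

/-- The 24 terms fall into the six ordered splittings of the alternated arguments into two pairs;
each occurs four times by antisymmetry within the pairs. -/
theorem act_asym_four_curvQuad (hT : IsCurvatureMap T) (a b c d e f : V) :
    act (asymOp {.b2, .c2, .d2, .a2}) (curvQuad β T) (idxVec a b c d e f)
      = 4 * (β (T b a c) (T e d f) + β (T b d f) (T e a c) - β (T b a d) (T e c f)
        - β (T b c f) (T e a d) + β (T b a f) (T e c d) + β (T b c d) (T e a f)) := by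
  rw [act_asym_four]
  simp only [act_asym_three, curvQuad, idxVec]
  have h₁ := fun b => hT.antisymm b a c
  have h₂ := fun b => hT.antisymm b a d
  have h₃ := fun b => hT.antisymm b a f
  have h₄ := fun b => hT.antisymm b c d
  have h₅ := fun b => hT.antisymm b c f
  have h₆ := fun b => hT.antisymm b d f
  simp only [h₁, h₂, h₃, h₄, h₅, h₆, map_neg, LinearMap.neg_apply]
  ring

/-- This alternates b₁ together with the four column names, while d₁ = x is fixed. Every resulting
term contains a cyclic sum of T over its three arguments, which is zero. -/
theorem act_asym_four_curvQuad_bianchi (hT : IsCurvatureMap T) (x y p q r : V) :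
    (fun A : V → V → V → V → V → ℝ =>
      A x y p q r - A y x p q r - A p y x q r - A q y p x r - A r y p q x)
    (fun b z₁ z₂ z₃ z₄ => act (asymOp {.b2, .c2, .d2, .a2}) (curvQuad β T)
      (idxVec z₁ b z₂ z₃ x z₄)) = 0 := by
  simp only [act_asym_four_curvQuad hT]
  have B : ∀ u v w z, β (T u v w) z + β (T v w u) z + β (T w u v) z = 0 := by
    intro u v w z
    rw [← LinearMap.add_apply, ← LinearMap.add_apply, ← map_add, ← map_add, hT.bianchi]
    simp
  have h₁ := fun b => hT.antisymm b x y
  have h₂ := fun b => hT.antisymm b x p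
  have h₃ := fun b => hT.antisymm b x q
  have h₄ := fun b => hT.antisymm b x r
  have h₅ := fun b => hT.antisymm b y p
  have h₆ := fun b => hT.antisymm b y q
  have h₇ := fun b => hT.antisymm b y r
  have h₈ := fun b => hT.antisymm b p q
  have h₉ := fun b => hT.antisymm b p r
  have h₀ := fun b => hT.antisymm b q r
  have e₁ := B x y p (T x q r)
  have e₂ := B x y q (T x p r)
  have e₃ := B x y r (T x p q)
  have e₄ := B x p q (T x y r)
  have e₅ := B x p r (T x y q)
  have e₆ := B x q r (T x y p)
  have e₇ := B y p q (T x x r)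
  have e₈ := B y p r (T x x q)
  have e₉ := B y q r (T x x p)
  have e₀ := B p q r (T x x y)
  simp only [h₁, h₂, h₃, h₄, h₅, h₆, h₇, h₈, h₉, h₀, map_neg, LinearMap.neg_apply] at *
  linarith

/-- The alternated tensor C is symmetric in b₁, d₁, so it lies in S² ⊗ Λ⁴, of Young types (3,1,1,1)
and (2,1,1,1,1). Row symmetrisation detects only the first type; the five-fold alternation detects
the second, and vanishes by Bianchi. -/
theorem act_asym_four_curvQuad_eq_zero (hβ : ∀ v w, β v w = β w v) (hT : IsCurvatureMap T)
    (h : act (symOp {.b2, .b1, .d1} * asymOp {.b2, .c2, .d2, .a2}) (curvQuad β T) = 0) :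
    act (asymOp {.b2, .c2, .d2, .a2}) (curvQuad β T) = 0 := by
  rw [act_mul] at h
  set C := act (asymOp {.b2, .c2, .d2, .a2}) (curvQuad β T) with hC
  have hsymm : ∀ a b c d e f, C (idxVec a b c d e f) = C (idxVec a e c d b f) := by
    intro a b c d e f
    rw [hC, act_asym_four_curvQuad hT, act_asym_four_curvQuad hT]
    rw [hβ (T b a c), hβ (T b d f), hβ (T b a d), hβ (T b c f), hβ (T b a f), hβ (T b c d)]
    ring
  have hs : ∀ i ∈ ({.b2, .c2, .d2, .a2} : Finset Idx), ∀ j ∈ ({.b2, .c2, .d2, .a2} : Finset Idx),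
      i ≠ j → ∀ v w, (w = fun l => v (Equiv.swap i j l)) → C w = -C v := by
    rintro i hi j hj hij v w rfl
    have hσ : Equiv.swap i j ∈ permsOf ({.b2, .c2, .d2, .a2} : Finset Idx) := by
      rw [mem_permsOf]
      intro l hl
      exact Equiv.swap_apply_of_ne_of_ne (fun e => hl (e ▸ hi)) (fun e => hl (e ▸ hj))
    rw [hC, act_asymOp_perm hσ, Equiv.Perm.sign_swap hij]
    simp
  have hs₁ : ∀ a b c d e f, C (idxVec a b c d e f) = -C (idxVec c b a d e f) := by
    intro a b c d e f
    refine hs .b2 (by decide) .a2 (by decide) (by decide) _ _ ?_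
    funext l; cases l <;> rfl
  have hs₂ : ∀ a b c d e f, C (idxVec a b c d e f) = -C (idxVec a b d c e f) := by
    intro a b c d e f
    refine hs .b2 (by decide) .c2 (by decide) (by decide) _ _ ?_
    funext l; cases l <;> rfl
  have hs₃ : ∀ a b c d e f, C (idxVec a b c d e f) = -C (idxVec a b f d e c) := by
    intro a b c d e f
    refine hs .b2 (by decide) .d2 (by decide) (by decide) _ _ ?_
    funext l; cases l <;> rfl
  have pol : ∀ a d f x y, C (idxVec a x y d x f) + 2 * C (idxVec a y x d x f) = 0 := by
    intro a d f x y
    have e := congrFun h (idxVec a x y d x f)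
    rw [act_sym_three, hsymm a x x d y f, Pi.zero_apply] at e
    linarith
  -- By `pol`, exchanging x in slot b₁ with an alternated argument multiplies the value by −1/2. The
  -- five-term identity thus becomes (1 + 4 · 1/2) C = 0.
  have diag : ∀ a c d f x, C (idxVec a x c d x f) = 0 := by
    intro y p q r x
    have e := act_asym_four_curvQuad_bianchi (β := β) hT x y p q r
    simp only [← hC] at e
    have p₁ := pol p q r x y
    have p₂ := pol y q r x p
    have p₃ := pol y p r x q
    have p₄ := pol y q p x r
    rw [hs₁ p, hs₁ p] at p₁
    rw [hs₂ y x q, hs₂ y q x p] at p₃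
    rw [hs₃ y x r, hs₃ y r x] at p₄
    linarith
  have hM : IsMultilin C := isMultilin_curvQuad.act _
  funext v
  rw [eq_idxVec v]
  have d₁ := diag (v .a2) (v .b2) (v .c2) (v .d2) (v .b1 + v .d1)
  have a₁ := hM.update_add (idxVec (v .a2) (v .b1) (v .b2) (v .c2) (v .b1 + v .d1) (v .d2)) .b1
    (v .b1) (v .d1)
  have a₂ := fun b => hM.update_add (idxVec (v .a2) b (v .b2) (v .c2) (v .b1) (v .d2)) .d1
    (v .b1) (v .d1)
  simp only [update_idxVec_b1, update_idxVec_d1] at a₁ a₂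
  rw [a₁, a₂, a₂, diag, diag, hsymm _ (v .d1)] at d₁
  rw [Pi.zero_apply]
  linarith

/-- By Bianchi, alternating one symmetrised factor in its two column names gives (3/2)T instead of
2T. Both factors are alternated here, so the ratio is (3/4)². -/
theorem act_asym_four_symCurvQuad (hT : IsCurvatureMap T) :
    act (asymOp {.b2, .c2, .d2, .a2}) (symCurvQuad β T)
      = (9 / 16 : ℝ) • act (asymOp {.b2, .c2, .d2, .a2}) (curvQuad β T) := by
  funext v
  rw [eq_idxVec v, Pi.smul_apply, act_asym_four_curvQuad hT, act_asym_four]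
  generalize v .a2 = a, v .b1 = b, v .b2 = c, v .c2 = d, v .d1 = e, v .d2 = f
  simp only [act_asym_three, symCurvQuad, idxVec]
  have hS : ∀ b p q, (1 / 2 : ℝ) • (T b p q + T q p b) - (1 / 2 : ℝ) • (T b q p + T p q b)
      = (3 / 2 : ℝ) • T b p q := by
    intro b p q
    have h₁ := hT.bianchi b p q
    have h₂ : T p q b = -T b p q - T q b p := by
      rw [← sub_eq_zero, ← h₁]; abel
    rw [hT.antisymm q b p, hT.antisymm b p q, h₂]
    module
  have key : ∀ p q r s, β ((1 / 2 : ℝ) • (T b p q + T q p b) - (1 / 2 : ℝ) • (T b q p + T p q b))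
      ((1 / 2 : ℝ) • (T e r s + T s r e) - (1 / 2 : ℝ) • (T e s r + T r s e))
      = 9 / 4 * β (T b p q) (T e r s) := by
    intro p q r s
    rw [hS, hS, map_smul, map_smul, LinearMap.smul_apply, smul_eq_mul, smul_eq_mul]
    ring
  have k₁ := key a c d f
  have k₂ := key d f a c
  have k₃ := key a d c f
  have k₄ := key c f a d
  have k₅ := key a f c d
  have k₆ := key c d a f
  simp only [map_sub, LinearMap.sub_apply] at k₁ k₂ k₃ k₄ k₅ k₆
  rw [smul_eq_mul]
  linear_combination k₁ + k₂ - k₃ - k₄ + k₅ + k₆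

/-- With b₁ = d₁ the two orders of each splitting agree by symmetry of β, which doubles the factor
4. -/
theorem act_asym_four_curvQuad_diag (hβ : ∀ v w, β v w = β w v) (hT : IsCurvatureMap T)
    (x p q r : V) : act (asymOp {.b2, .c2, .d2, .a2}) (curvQuad β T) (idxVec p x x q x r)
      = 8 * curvCubic β T x p q r := by
  rw [act_asym_four_curvQuad hT, curvCubic, hβ (T x q r), hβ (T x x r), hβ (T x x q),
    hT.antisymm x r x, hT.antisymm x q x, hT.antisymm x r p, hβ (T x q x), hβ (T x r x)]
  simp only [map_neg, LinearMap.neg_apply]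
  ring

/-- All four symmetry conditions on the quadratic curvature expression are equivalent. -/
theorem act_symmetryOp_curvQuad_eq_zero_iff (hβ : ∀ v w, β v w = β w v) (hT : IsCurvatureMap T)
    (k : Fin 4) : act (symmetryOp k) (curvQuad β T) = 0 ↔ ∀ x p q r, curvCubic β T x p q r = 0 := by
  have hC : (∀ x p q r, curvCubic β T x p q r = 0) →
      act (symOp {.b2, .b1, .d1} * asymOp {.b2, .c2, .d2, .a2}) (curvQuad β T) = 0 := by
    intro h
    rw [act_mul]
    refine act_symOp_three_eq_zero (isMultilin_curvQuad.act _) fun a d f x => ?_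
    rw [act_sym_three_diag, act_asym_four_curvQuad_diag hβ hT, h, mul_zero, mul_zero]
  have hD : act (symOp {.b2, .b1, .d1} * asymOp {.b2, .c2, .d2, .a2}) (curvQuad β T) = 0 →
      ∀ x p q r, curvCubic β T x p q r = 0 := by
    intro h x p q r
    have e := congrFun h (idxVec p x x q x r)
    rw [act_mul, act_sym_three_diag, act_asym_four_curvQuad_diag hβ hT, Pi.zero_apply] at e
    linarith
  fin_cases k
  · exact act_adjoint_hook_eq_zero_iff hβ hT isMultilin_curvQuad (by norm_num)
      (act_asym_sym_curvQuad hT)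
  · exact act_asym_sym_eq_zero_iff isMultilin_curvQuad (by norm_num) (act_asym_sym_curvQuad hT)
  · refine ⟨fun h => hD ?_, fun h => act_asym_four_curvQuad_eq_zero hβ hT (hC h)⟩
    change act (asymOp {.b2, .c2, .d2, .a2}) (curvQuad β T) = 0 at h
    rw [act_mul, h, act_tensor_zero]
  · change act hook _ = 0 ↔ _
    rw [hook_eq]
    exact ⟨hD, hC⟩

/-- All four symmetry conditions on the symmetrised quadratic expression are equivalent. -/
theorem act_symmetryOp_symCurvQuad_eq_zero_iff (hβ : ∀ v w, β v w = β w v)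
    (hT : IsCurvatureMap T) (k : Fin 4) :
    act (symmetryOp k) (symCurvQuad β T) = 0 ↔ ∀ x p q r, curvCubic β T x p q r = 0 := by
  fin_cases k
  · exact act_adjoint_hook_eq_zero_iff hβ hT isMultilin_symCurvQuad (by norm_num)
      (act_asym_sym_symCurvQuad hT)
  · exact act_asym_sym_eq_zero_iff isMultilin_symCurvQuad (by norm_num)
      (act_asym_sym_symCurvQuad hT)
  · refine Iff.trans ?_ (act_symmetryOp_curvQuad_eq_zero_iff hβ hT 2)
    change act (asymOp {.b2, .c2, .d2, .a2}) _ = 0 ↔ act (asymOp {.b2, .c2, .d2, .a2}) _ = 0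
    rw [act_asym_four_symCurvQuad hT, smul_eq_zero_iff_right (by norm_num)]
  · refine Iff.trans ?_ (act_symmetryOp_curvQuad_eq_zero_iff hβ hT 3)
    change act hook _ = 0 ↔ act hook _ = 0
    rw [hook_eq, act_mul, act_asym_four_symCurvQuad hT, act_tensor_smul, ← act_mul,
      smul_eq_zero_iff_right (by norm_num)]

end Quad

/-! ### Index raising -/

theorem InnerProd.form_sharp (g : InnerProd V) (f : V →ₗ[ℝ] ℝ) (w : V) :
    g.form (g.sharp f) w = f w := by
  rw [InnerProd.sharp, LinearMap.BilinForm.apply_toDual_symm_apply]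

theorem InnerProd.form_comm (g : InnerProd V) (v w : V) : g.form v w = g.form w v :=
  g.symm.eq v w

theorem InnerProd.form_raise (g : InnerProd V) (R : Tensor4 V) (a b c e : V) :
    g.form (raise g R a b c) e = R ![e, a, b, c] :=
  g.form_sharp _ _

theorem InnerProd.ext_form (g : InnerProd V) {v w : V} (h : ∀ z, g.form v z = g.form w z) :
    v = w := by
  have := g.form.toDual g.nondeg |>.injective (a₁ := v) (a₂ := w)
  refine this (LinearMap.ext fun z => ?_)
  simpa [LinearMap.BilinForm.toDual_def] using h z

/-- `raise` as a trilinear map. -/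
def raiseMap (g : InnerProd V) (R : Tensor4 V) : V →ₗ[ℝ] V →ₗ[ℝ] V →ₗ[ℝ] V :=
  LinearMap.mk₂ ℝ (fun a b =>
    { toFun := fun c => raise g R a b c
      map_add' := fun c c' => by simp [raise, InnerProd.sharp, slot_add_three]
      map_smul' := fun r c => by simp [raise, InnerProd.sharp, slot_smul_three] })
    (fun a a' b => by ext c; simp [raise, InnerProd.sharp, slot_add_one])
    (fun r a b => by ext c; simp [raise, InnerProd.sharp, slot_smul_one])
    (fun a b b' => by ext c; simp [raise, InnerProd.sharp, slot_add_two])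
    (fun r a b => by ext c; simp [raise, InnerProd.sharp, slot_smul_two])

theorem form_raiseMap (g : InnerProd V) (R : Tensor4 V) (a b c e : V) :
    g.form (raiseMap g R a b c) e = R ![e, a, b, c] :=
  g.form_raise _ _ _ _ _

theorem IsCurvature.isCurvatureMap (g : InnerProd V) {R : Tensor4 V} (hR : IsCurvature R) :
    IsCurvatureMap (raiseMap g R) where
  antisymm b p q := g.ext_form fun z => by
    simp only [map_neg, LinearMap.neg_apply, form_raiseMap]
    exact hR.antisymm_right _ _ _ _
  bianchi b p q := g.ext_form fun z => by
    simp only [map_add, LinearMap.add_apply, form_raiseMap, map_zero, LinearMap.zero_apply]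
    exact hR.bianchi _ _ _ _

/-- The form `ḡ` as a bilinear form. -/
def Model.gbarForm {g : InnerProd V} : Model g → LinearMap.BilinForm ℝ V
  | .sphere => g.form
  | .hyperplane u _ => g.form - LinearMap.BilinForm.linMulLin (g.form u) (g.form u)

theorem Model.gbarForm_apply {g : InnerProd V} (Q : Model g) (v w : V) :
    Q.gbarForm v w = Q.gbar v w := by
  cases Q <;> simp [Model.gbarForm, Model.gbar]

theorem Model.gbarForm_comm {g : InnerProd V} (Q : Model g) (v w : V) :
    Q.gbarForm v w = Q.gbarForm w v := by
  rw [Q.gbarForm_apply, Q.gbarForm_apply]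
  cases Q <;> simp only [Model.gbar, g.form_comm v w]
  ring

theorem quadR_eq_curvQuad {g : InnerProd V} (Q : Model g) (R : Tensor4 V) :
    quadR Q R = curvQuad Q.gbarForm (raiseMap g R) := by
  funext v
  rw [curvQuad, Q.gbarForm_apply]; rfl

/-! ### The two kinds of curvature tensors -/

/-- The algebraic curvature tensor of a symmetrised algebraic curvature tensor. -/
def toCurvature (S : Tensor4 V) : Tensor4 V :=
  (2 / 3 : ℝ) • (S.domDomCongr (Equiv.swap 1 2)
    - S.domDomCongr (Equiv.swap 1 2 * Equiv.swap 1 3 : Equiv.Perm (Fin 4)))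

theorem toCurvature_apply (S : Tensor4 V) (a b c d : V) :
    toCurvature S ![a, b, c, d] = 2 / 3 * (S ![a, c, b, d] - S ![a, d, b, c]) := by
  have h₁ : (fun i => ![a, b, c, d] (Equiv.swap 1 2 i)) = ![a, c, b, d] := by
    funext i; fin_cases i <;> rfl
  have h₂ : (fun i => ![a, b, c, d] ((Equiv.swap 1 2 * Equiv.swap 1 3 : Equiv.Perm (Fin 4)) i))
      = ![a, d, b, c] := by
    funext i; fin_cases i <;> rfl
  rw [← h₁, ← h₂]
  rfl

theorem IsSymCurvature.toCurvature {S : Tensor4 V} (hS : IsSymCurvature S) :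
    IsCurvature (toCurvature S) where
  antisymm_left a₁ b₁ a₂ b₂ := by
    rw [toCurvature_apply, toCurvature_apply, ← hS.pair a₁ b₂ b₁ a₂, ← hS.pair a₁ a₂ b₁ b₂]
    ring
  antisymm_right a₁ b₁ a₂ b₂ := by
    rw [toCurvature_apply, toCurvature_apply]
    ring
  pair a₁ b₁ a₂ b₂ := by
    have h₁ : S ![a₂, a₁, b₂, b₁] = S ![a₁, a₂, b₁, b₂] := by rw [hS.symm_left, hS.symm_right]
    have h₂ : S ![a₂, b₁, b₂, a₁] = S ![a₁, b₂, b₁, a₂] := by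
      rw [hS.pair, hS.symm_left, hS.symm_right]
    rw [toCurvature_apply, toCurvature_apply, h₁, h₂]
  bianchi a₁ b₁ a₂ b₂ := by
    simp only [toCurvature_apply]
    rw [hS.symm_right a₁ b₁ b₂ a₂, hS.symm_right a₁ a₂ b₁ b₂, hS.symm_right a₁ b₂ b₁ a₂]
    ring

/-- The factor 2/3 in `toCurvature` is fixed by this inversion: the Bianchi identity makes the
symmetrised difference of S-terms equal to 3S. -/
theorem IsSymCurvature.eq_toCurvature {S : Tensor4 V} (hS : IsSymCurvature S) (a b c d : V) :
    S ![a, b, c, d] = 1 / 2 * (KillingNijenhuis.toCurvature S ![a, c, b, d]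
      + KillingNijenhuis.toCurvature S ![a, d, b, c]) := by
  have := hS.bianchi a b c d
  rw [toCurvature_apply, toCurvature_apply, hS.symm_right a b c d, hS.symm_right a d b c]
  linarith

theorem quadS_eq_symCurvQuad {g : InnerProd V} (Q : Model g) {S : Tensor4 V}
    (hS : IsSymCurvature S) :
    quadS Q S = symCurvQuad Q.gbarForm (raiseMap g (toCurvature S)) := by
  have h : ∀ a b c, raise g S a b c = (1 / 2 : ℝ) • (raiseMap g (toCurvature S) b a c
      + raiseMap g (toCurvature S) c a b) := fun a b c => g.ext_form fun z => by
    simp only [map_smul, map_add, LinearMap.smul_apply, LinearMap.add_apply, form_raiseMap,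
      g.form_raise, smul_eq_mul]
    exact hS.eq_toCurvature _ _ _ _
  funext v
  rw [symCurvQuad, ← h, ← h, Q.gbarForm_apply]; rfl

/-! ### The wedge square of the curvature form -/

/-- The slots of the wedge product of two two-forms, as index names. -/
def slotEquiv : Fin 2 ⊕ Fin 2 ≃ {l : Idx // l ∈ ({.b2, .c2, .d2, .a2} : Finset Idx)} where
  toFun := Sum.elim ![⟨.a2, by decide⟩, ⟨.b2, by decide⟩] ![⟨.c2, by decide⟩, ⟨.d2, by decide⟩]
  invFun l := match l with
    | ⟨.a2, _⟩ => .inl 0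
    | ⟨.b2, _⟩ => .inl 1
    | ⟨.c2, _⟩ => .inr 0
    | ⟨.d2, _⟩ => .inr 1
    -- The names b₁ and d₁ do not belong to the subtype, so these two values are arbitrary.
    | ⟨.b1, _⟩ => .inl 0
    | ⟨.d1, _⟩ => .inl 0
  left_inv i := by rcases i with i | i <;> fin_cases i <;> rfl
  right_inv l := by
    rcases l with ⟨l, hl⟩
    cases l <;> first | rfl | exact absurd hl (by decide)

theorem sum_permsOf_eq {M : Type*} [AddCommMonoid M] (f : Equiv.Perm Idx → M) :
    ∑ π ∈ permsOf {.b2, .c2, .d2, .a2}, f π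
      = ∑ σ : Equiv.Perm (Fin 2 ⊕ Fin 2), f (σ.extendDomain slotEquiv) := by
  symm
  refine Finset.sum_bij (fun σ _ => σ.extendDomain slotEquiv) ?_ ?_ ?_ ?_
  · intro σ _
    rw [mem_permsOf]
    intro l hl
    exact Equiv.Perm.extendDomain_apply_not_subtype _ _ hl
  · intro σ _ τ _ h
    exact Equiv.Perm.extendDomainHom_injective slotEquiv h
  · intro π hπ
    rw [mem_permsOf] at hπ
    have hp : ∀ l, π l ∈ ({.b2, .c2, .d2, .a2} : Finset Idx) ↔
        l ∈ ({.b2, .c2, .d2, .a2} : Finset Idx) := by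
      intro l
      constructor
      · intro h
        by_contra hc
        rw [hπ l hc] at h
        exact hc h
      · intro h
        by_contra hc
        rw [π.injective (hπ _ hc)] at hc
        exact hc h
    refine ⟨slotEquiv.symm.permCongr (π.subtypePerm hp), Finset.mem_univ _, ?_⟩
    ext l
    by_cases hl : l ∈ ({.b2, .c2, .d2, .a2} : Finset Idx)
    · rw [Equiv.Perm.extendDomain_apply_subtype _ _ hl]
      simp
    · rw [Equiv.Perm.extendDomain_apply_not_subtype _ _ hl, hπ l hl]
  · intros; rfl

/-- Composition of endomorphisms becomes contraction with g once w is moved from the first to the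
second slot of R; that exchange causes the minus sign. -/
theorem form_wedge_curvatureForm (g : InnerProd V) {R : Tensor4 V} (hR : IsCurvature R)
    (m : Fin 2 ⊕ Fin 2 → V) (y w : V) :
    g.form (wedge (curvatureForm g R) (curvatureForm g R) m y) w
      = -act (asymOp {.b2, .c2, .d2, .a2}) (curvQuad g.form (raiseMap g R))
        (idxVec (m (.inl 0)) w (m (.inl 1)) (m (.inr 0)) y (m (.inr 1))) := by
  have hΩ : ∀ (p : Fin 2 → V) z, curvatureForm g R p z = (2 : ℝ) • raiseMap g R z (p 0) (p 1) := by
    intro p z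
    change raiseMap g R z (p 0) (p 1) - raiseMap g R z (p 1) (p 0) = _
    rw [(hR.isCurvatureMap g).antisymm z (p 0) (p 1)]
    module
  have hm : ∀ (σ : Equiv.Perm (Fin 2 ⊕ Fin 2)) i,
      idxVec (m (.inl 0)) w (m (.inl 1)) (m (.inr 0)) y (m (.inr 1))
        ((σ.extendDomain slotEquiv) (slotEquiv i)) = m (σ i) := by
    intro σ i
    rw [Equiv.Perm.extendDomain_apply_image]
    rcases σ i with j | j <;> fin_cases j <;> rfl
  have h4 := congrArg (fun A => g.form (LinearMap.mul' ℝ (Module.End ℝ V) (A m) y) w)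
    (MultilinearMap.domCoprod_alternization_eq (curvatureForm g R) (curvatureForm g R))
  -- The wedge sums over shuffles, the alternatisation over all permutations. Their ratio 2!·2! = 4
  -- cancels the 4 coming from Ω = 2R in both factors.
  have hr : g.form (LinearMap.mul' ℝ (Module.End ℝ V)
      (((Fintype.card (Fin 2)).factorial * (Fintype.card (Fin 2)).factorial)
        • (curvatureForm g R).domCoprod (curvatureForm g R) $ m) y) w
      = 4 * g.form (wedge (curvatureForm g R) (curvatureForm g R) m y) w := by
    rw [AlternatingMap.smul_apply, map_nsmul, Fintype.card_fin]
    change g.form (((2 * 2) • wedge (curvatureForm g R) (curvatureForm g R) m) y) w = _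
    rw [LinearMap.smul_apply, map_nsmul, LinearMap.smul_apply, nsmul_eq_mul]
    norm_num
  beta_reduce at h4
  rw [hr, MultilinearMap.alternatization_apply, map_sum, LinearMap.sum_apply, map_sum,
    LinearMap.sum_apply] at h4
  rw [act_asymOp, sum_permsOf_eq, ← mul_right_inj' (four_ne_zero (α := ℝ)), ← h4, mul_neg,
    Finset.mul_sum, ← Finset.sum_neg_distrib]
  refine Finset.sum_congr rfl fun σ _ => ?_
  have ht : LinearMap.mul' ℝ (Module.End ℝ V) (MultilinearMap.domDomCongr σ
      (((curvatureForm g R : MultilinearMap ℝ (fun _ : Fin 2 => V) (Module.End ℝ V))).domCoprod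
        (curvatureForm g R : MultilinearMap ℝ (fun _ : Fin 2 => V) (Module.End ℝ V))) m) y
      = (4 : ℝ) • raiseMap g R (raiseMap g R y (m (σ (.inr 0))) (m (σ (.inr 1))))
        (m (σ (.inl 0))) (m (σ (.inl 1))) := by
    change curvatureForm g R (fun i => m (σ (.inl i)))
      (curvatureForm g R (fun i => m (σ (.inr i))) y) = _
    rw [hΩ, hΩ, map_smul, LinearMap.smul_apply, LinearMap.smul_apply, smul_smul]
    norm_num
  have hq : curvQuad g.form (raiseMap g R) (fun l =>
      idxVec (m (.inl 0)) w (m (.inl 1)) (m (.inr 0)) y (m (.inr 1))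
        ((σ.extendDomain slotEquiv) l))
      = g.form (raiseMap g R w (m (σ (.inl 0))) (m (σ (.inl 1))))
        (raiseMap g R y (m (σ (.inr 0))) (m (σ (.inr 1)))) := by
    rw [← hm σ (.inl 0), ← hm σ (.inl 1), ← hm σ (.inr 0), ← hm σ (.inr 1)]
    rfl
  have hs : LinearMap.mul' ℝ (Module.End ℝ V) (Equiv.Perm.sign σ • MultilinearMap.domDomCongr σ
      (((curvatureForm g R : MultilinearMap ℝ (fun _ : Fin 2 => V) (Module.End ℝ V))).domCoprod
        (curvatureForm g R : MultilinearMap ℝ (fun _ : Fin 2 => V) (Module.End ℝ V))) m) y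
      = ((Equiv.Perm.sign σ : ℤ) : ℝ) • (4 : ℝ) • raiseMap g R
        (raiseMap g R y (m (σ (.inr 0))) (m (σ (.inr 1)))) (m (σ (.inl 0))) (m (σ (.inl 1))) := by
    rw [← ht]
    rcases Int.units_eq_one_or (Equiv.Perm.sign σ) with h | h <;> simp [h]
  rw [hs, hq, Equiv.Perm.sign_extendDomain, map_smul, LinearMap.smul_apply, map_smul,
    LinearMap.smul_apply, form_raiseMap, form_raiseMap, smul_eq_mul, smul_eq_mul,
    hR.antisymm_left]
  ring

theorem wedge_curvatureForm_eq_zero_iff (g : InnerProd V) {R : Tensor4 V} (hR : IsCurvature R) :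
    wedge (curvatureForm g R) (curvatureForm g R) = 0
      ↔ act (asymOp {.b2, .c2, .d2, .a2}) (curvQuad g.form (raiseMap g R)) = 0 := by
  constructor
  · intro h
    funext v
    have e := form_wedge_curvatureForm g hR (Sum.elim ![v .a2, v .b2] ![v .c2, v .d2])
      (v .d1) (v .b1)
    rw [h] at e
    rw [eq_idxVec v, Pi.zero_apply, ← neg_eq_zero]
    exact e.symm.trans (by simp)
  · intro h
    ext m y
    refine g.ext_form fun w => ?_
    rw [form_wedge_curvatureForm g hR, h]
    simp

section

/-! ### Continuity of multilinear maps -/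

/-- A trilinear map as a continuous trilinear map. -/
def toCLM₃ {F : Type*} [NormedAddCommGroup F] [NormedSpace ℝ F]
    (B : V →ₗ[ℝ] V →ₗ[ℝ] V →ₗ[ℝ] F) : V →L[ℝ] V →L[ℝ] V →L[ℝ] F :=
  LinearMap.toContinuousLinearMap
    { toFun := fun a => (B a).toContinuousBilinearMap
      map_add' := fun a a' => by ext; simp
      map_smul' := fun r a => by ext; simp }

@[simp]
theorem toCLM₃_apply {F : Type*} [NormedAddCommGroup F] [NormedSpace ℝ F]
    (B : V →ₗ[ℝ] V →ₗ[ℝ] V →ₗ[ℝ] F) (u v w : V) : toCLM₃ B u v w = B u v w := rfl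

/-- The ambient form as a continuous bilinear form. -/
def InnerProd.formL (g : InnerProd V) : V →L[ℝ] V →L[ℝ] ℝ := g.form.toContinuousBilinearMap

@[simp]
theorem InnerProd.formL_apply (g : InnerProd V) (v w : V) : g.formL v w = g.form v w := rfl

/-- Index raising as a continuous linear map. -/
def InnerProd.sharpL (g : InnerProd V) : (V →L[ℝ] ℝ) →L[ℝ] V :=
  LinearMap.toContinuousLinearMap
    { toFun := fun f => g.sharp (f : V →ₗ[ℝ] ℝ)
      map_add' := fun a a' => by simp [InnerProd.sharp]
      map_smul' := fun r a => by simp [InnerProd.sharp] }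

/-! ### The radial retraction onto the model -/

namespace Model

variable {g : InnerProd V}

/-- The defining function of the model, equal to `1` exactly on the model. -/
def level : Model g → V → ℝ
  | sphere => fun y => g.form y y
  | hyperplane u _ => fun y => g.form y u

/-- The function homogeneous of degree one on the cone over the model that is `1` on the model. -/
def radius : Model g → V → ℝ
  | sphere => fun y => Real.sqrt (g.form y y)
  | hyperplane u _ => fun y => g.form y u

/-- The radial retraction onto the model. -/
def retract (Q : Model g) (y : V) : V := (Q.radius y)⁻¹ • y

theorem mem_carrier_iff (Q : Model g) (x : V) : x ∈ Q.carrier ↔ Q.level x = 1 := by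
  cases Q <;> rfl

theorem contDiff_level (Q : Model g) : ContDiff ℝ ∞ Q.level := by
  cases Q with
  | sphere => exact g.formL.contDiff.clm_apply contDiff_id
  | hyperplane u hu => exact g.formL.contDiff.clm_apply contDiff_const

theorem contDiff_normal (Q : Model g) : ContDiff ℝ ∞ Q.normal := by
  cases Q with
  | sphere => exact contDiff_id
  | hyperplane u hu => exact contDiff_const

theorem form_normal_self (Q : Model g) {x : V} (hx : x ∈ Q.carrier) :
    g.form (Q.normal x) x = 1 := by
  cases Q with
  | sphere => exact hx
  | hyperplane u hu => exact (g.form_comm _ _).trans hx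

theorem form_normal_normal (Q : Model g) {x : V} (hx : x ∈ Q.carrier) :
    g.form (Q.normal x) (Q.normal x) = 1 := by
  cases Q with
  | sphere => exact hx
  | hyperplane u hu => exact hu

theorem mem_tangent_iff (Q : Model g) (x v : V) :
    v ∈ Q.tangent x ↔ g.form (Q.normal x) v = 0 := LinearMap.mem_ker

theorem proj_mem_tangent (Q : Model g) {x : V} (hx : x ∈ Q.carrier) (v : V) :
    Q.proj x v ∈ Q.tangent x := by
  rw [mem_tangent_iff, proj, map_sub, map_smul, Q.form_normal_normal hx]
  simp

theorem proj_eq_self (Q : Model g) {x v : V} (hv : v ∈ Q.tangent x) : Q.proj x v = v := by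
  rw [mem_tangent_iff] at hv
  simp [proj, hv]

theorem form_proj_left (Q : Model g) {x z : V} (hz : z ∈ Q.tangent x) (v : V) :
    g.form (Q.proj x v) z = g.form v z := by
  rw [mem_tangent_iff] at hz
  simp [proj, hz]

theorem radius_pos (Q : Model g) {y : V} (hy : 0 < Q.level y) : 0 < Q.radius y := by
  cases Q with
  | sphere => exact Real.sqrt_pos.2 hy
  | hyperplane u hu => exact hy

theorem level_smul (Q : Model g) {t : ℝ} (ht : 0 < t) {x : V} (hx : x ∈ Q.carrier) :
    0 < Q.level (t • x) := by
  rw [mem_carrier_iff] at hx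
  cases Q with
  | sphere =>
    change g.form x x = 1 at hx
    simp [level, hx, ht]
  | hyperplane u hu =>
    change g.form x u = 1 at hx
    simp [level, hx, ht]

theorem radius_smul (Q : Model g) {t : ℝ} (ht : 0 < t) (y : V) :
    Q.radius (t • y) = t * Q.radius y := by
  cases Q with
  | sphere =>
    simp only [radius, map_smul, LinearMap.smul_apply, smul_eq_mul]
    rw [← mul_assoc, Real.sqrt_mul (by positivity), Real.sqrt_mul_self ht.le]
  | hyperplane u hu => simp [radius]

theorem radius_eq_one (Q : Model g) {x : V} (hx : x ∈ Q.carrier) : Q.radius x = 1 := by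
  rw [mem_carrier_iff] at hx
  cases Q with
  | sphere => change g.form x x = 1 at hx; simp [radius, hx]
  | hyperplane u hu => exact hx

theorem retract_mem_carrier (Q : Model g) {y : V} (hy : 0 < Q.level y) :
    Q.retract y ∈ Q.carrier := by
  have hr := Q.radius_pos hy
  rw [mem_carrier_iff, retract]
  cases Q with
  | sphere =>
    simp only [level, radius, map_smul, LinearMap.smul_apply, smul_eq_mul] at *
    have h2 : g.form y y = Real.sqrt (g.form y y) * Real.sqrt (g.form y y) :=
      (Real.mul_self_sqrt hy.le).symm
    rw [h2, Real.sqrt_mul_self (Real.sqrt_nonneg _)]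
    field_simp
  | hyperplane u hu =>
    simp only [level, radius, map_smul, LinearMap.smul_apply, smul_eq_mul] at *
    field_simp

theorem retract_eq_self (Q : Model g) {x : V} (hx : x ∈ Q.carrier) : Q.retract x = x := by
  rw [retract, Q.radius_eq_one hx, inv_one, one_smul]

theorem retract_smul (Q : Model g) {t : ℝ} (ht : 0 < t) (y : V) :
    Q.retract (t • y) = Q.retract y := by
  rw [retract, Q.radius_smul ht, retract, smul_smul]
  congr 1
  field_simp

theorem radius_smul_retract (Q : Model g) {y : V} (hy : 0 < Q.level y) :
    Q.radius y • Q.retract y = y := by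
  rw [retract, smul_smul, mul_inv_cancel₀ (Q.radius_pos hy).ne', one_smul]

theorem contDiffAt_radius (Q : Model g) {y : V} (hy : 0 < Q.level y) :
    ContDiffAt ℝ ∞ Q.radius y := by
  cases Q with
  | sphere => exact (contDiff_level (sphere (g := g))).contDiffAt.sqrt hy.ne'
  | hyperplane u hu => exact (contDiff_level (hyperplane u hu)).contDiffAt

theorem contDiffAt_retract (Q : Model g) {y : V} (hy : 0 < Q.level y) :
    ContDiffAt ℝ ∞ Q.retract y :=
  ((Q.contDiffAt_radius hy).inv (Q.radius_pos hy).ne').smul contDiffAt_id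

theorem fderiv_radius (Q : Model g) {x : V} (hx : x ∈ Q.carrier) (w : V) :
    fderiv ℝ Q.radius x w = g.form (Q.normal x) w := by
  have hl := (Q.mem_carrier_iff x).1 hx
  cases Q with
  | sphere =>
    have h1 := g.formL.hasFDerivAt (x := x) |>.clm_apply (hasFDerivAt_id x)
    change g.formL x (id x) = 1 at hl
    have h2 := h1.sqrt (by rw [hl]; exact one_ne_zero)
    change fderiv ℝ (fun y => Real.sqrt (g.formL y (id y))) x w = g.form x w
    rw [h2.fderiv, hl]
    simp [g.form_comm w x]
    ring
  | hyperplane u hu =>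
    change fderiv ℝ (fun y => g.formL.flip u y) x w = _
    rw [ContinuousLinearMap.fderiv]
    exact g.form_comm _ _

/-- On tangent vectors the derivative is the identity. Composing with the retraction therefore
leaves tangential derivatives on M unchanged. -/
theorem fderiv_retract (Q : Model g) {x : V} (hx : x ∈ Q.carrier) (w : V) :
    fderiv ℝ Q.retract x w = w - g.form (Q.normal x) w • x := by
  have hl : 0 < Q.level x := by rw [(Q.mem_carrier_iff x).1 hx]; exact one_pos
  have h1 := ((Q.contDiffAt_radius hl).differentiableAt (by simp)).hasFDerivAt
  have h2 := ((hasDerivAt_inv (Q.radius_pos hl).ne').comp_hasFDerivAt x h1).smul (hasFDerivAt_id x)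
  change fderiv ℝ ((fun y => y⁻¹) ∘ Q.radius • id) x w = _
  rw [HasFDerivAt.fderiv h2]
  simp [Q.radius_eq_one hx, Q.fderiv_radius hx]
  module

theorem isOpen_level_pos (Q : Model g) : IsOpen {y | 0 < Q.level y} :=
  isOpen_lt continuous_const Q.contDiff_level.continuous

/-- The open cone over `M`. -/
def cone (Q : Model g) (U : Set V) : Set V := {y | 0 < Q.level y ∧ Q.retract y ∈ U}

theorem isOpen_cone (Q : Model g) {U : Set V} (hU : IsOpen U) : IsOpen (Q.cone U) :=
  ContinuousOn.isOpen_inter_preimage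
    (fun _ hy => (Q.contDiffAt_retract hy).continuousAt.continuousWithinAt) Q.isOpen_level_pos hU

theorem retract_mem_patch (Q : Model g) {U : Set V} {y : V} (hy : y ∈ Q.cone U) :
    Q.retract y ∈ Q.patch U := ⟨hy.2, Q.retract_mem_carrier hy.1⟩

theorem smul_mem_cone (Q : Model g) {U : Set V} {t : ℝ} (ht : 0 < t) {x : V}
    (hx : x ∈ Q.patch U) : t • x ∈ Q.cone U :=
  ⟨Q.level_smul ht hx.2, by rw [Q.retract_smul ht, Q.retract_eq_self hx.2]; exact hx.1⟩

theorem mem_cone (Q : Model g) {U : Set V} {x : V} (hx : x ∈ Q.patch U) : x ∈ Q.cone U := by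
  simpa using Q.smul_mem_cone one_pos hx

theorem cone_eq_image (Q : Model g) (U : Set V) :
    Q.cone U = (fun p : ℝ × V => p.1 • p.2) '' (Set.Ioi 0 ×ˢ Q.patch U) := by
  ext y
  constructor
  · intro hy
    exact ⟨(Q.radius y, Q.retract y), ⟨Q.radius_pos hy.1, Q.retract_mem_patch hy⟩,
      Q.radius_smul_retract hy.1⟩
  · rintro ⟨⟨t, x⟩, ⟨ht, hx⟩, rfl⟩
    exact Q.smul_mem_cone ht hx

theorem isPreconnected_cone (Q : Model g) {U : Set V} (h : IsPreconnected (Q.patch U)) :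
    IsPreconnected (Q.cone U) := by
  rw [cone_eq_image]
  exact (isPreconnected_Ioi.prod h).image _ (continuous_fst.smul continuous_snd).continuousOn

/-- The derivative at a point of `M` in a tangent direction depends only on the values on `M`. -/
theorem fderiv_eq_of_eqOn {E : Type*} [NormedAddCommGroup E] [NormedSpace ℝ E] (Q : Model g)
    {U : Set V} (hU : IsOpen U) {f h : V → E} {x w : V} (hx : x ∈ Q.patch U)
    (hw : w ∈ Q.tangent x) (hf : DifferentiableAt ℝ f x) (hh : DifferentiableAt ℝ h x)
    (hfh : Set.EqOn f h (Q.patch U)) : fderiv ℝ f x w = fderiv ℝ h x w := by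
  have hxc := Q.mem_cone hx
  have hρ := (Q.contDiffAt_retract hxc.1).differentiableAt (by simp)
  have hρw : fderiv ℝ Q.retract x w = w := by
    rw [mem_tangent_iff] at hw
    rw [Q.fderiv_retract hx.2, hw, zero_smul, sub_zero]
  -- After composition with the retraction, the two functions agree on a whole neighbourhood and not
  -- only on M.
  have key : ∀ k : V → E, DifferentiableAt ℝ k x →
      fderiv ℝ k x w = fderiv ℝ (k ∘ Q.retract) x w := by
    intro k hk
    have hk' : DifferentiableAt ℝ k (Q.retract x) := by rwa [Q.retract_eq_self hx.2]
    rw [fderiv_comp x hk' hρ, ContinuousLinearMap.comp_apply, hρw, Q.retract_eq_self hx.2]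
  rw [key f hf, key h hh]
  have : f ∘ Q.retract =ᶠ[nhds x] h ∘ Q.retract := by
    filter_upwards [(Q.isOpen_cone hU).mem_nhds hxc] with y hy
    exact hfh (Q.retract_mem_patch hy)
  rw [this.fderiv_eq]

end Model

end

section

/-! ### The Nijenhuis torsion of a Killing tensor -/

theorem sum_sign_perm_fin_three (f : Fin 3 → Fin 3 → Fin 3 → ℝ) :
    ∑ σ : Equiv.Perm (Fin 3), ((Equiv.Perm.sign σ : ℤ) : ℝ) * f (σ 0) (σ 1) (σ 2)
      = f 0 1 2 + f 1 2 0 + f 2 0 1 - f 1 0 2 - f 0 2 1 - f 2 1 0 := by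
  have h : (Finset.univ : Finset (Equiv.Perm (Fin 3))) = {1, Equiv.swap 0 1 * Equiv.swap 1 2,
    Equiv.swap 0 2 * Equiv.swap 1 2, Equiv.swap 0 1, Equiv.swap 1 2, Equiv.swap 0 2} := by decide
  rw [h, Finset.sum_insert (by decide), Finset.sum_insert (by decide),
    Finset.sum_insert (by decide), Finset.sum_insert (by decide), Finset.sum_insert (by decide),
    Finset.sum_singleton]
  have s₀ : (Equiv.swap 0 1 * Equiv.swap 1 2 : Equiv.Perm (Fin 3)) 0 = 1 := by decide
  have s₁ : (Equiv.swap 0 1 * Equiv.swap 1 2 : Equiv.Perm (Fin 3)) 1 = 2 := by decide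
  have s₂ : (Equiv.swap 0 1 * Equiv.swap 1 2 : Equiv.Perm (Fin 3)) 2 = 0 := by decide
  have t₀ : (Equiv.swap 0 2 * Equiv.swap 1 2 : Equiv.Perm (Fin 3)) 0 = 2 := by decide
  have t₁ : (Equiv.swap 0 2 * Equiv.swap 1 2 : Equiv.Perm (Fin 3)) 1 = 0 := by decide
  have t₂ : (Equiv.swap 0 2 * Equiv.swap 1 2 : Equiv.Perm (Fin 3)) 2 = 1 := by decide
  have u₀ : (Equiv.swap 0 1 : Equiv.Perm (Fin 3)) 2 = 2 := by decide
  have u₁ : (Equiv.swap 1 2 : Equiv.Perm (Fin 3)) 0 = 0 := by decide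
  have u₂ : (Equiv.swap 0 2 : Equiv.Perm (Fin 3)) 1 = 1 := by decide
  rw [s₀, s₁, s₂, t₀, t₁, t₂, u₀, u₁, u₂]
  simp [Equiv.Perm.sign_mul]
  ring

variable {g : InnerProd V} {Q : Model g} {U : Set V}

theorem Model.ext_tangent {x v w : V} (hx : x ∈ Q.carrier) (hv : v ∈ Q.tangent x)
    (hw : w ∈ Q.tangent x) (h : ∀ z ∈ Q.tangent x, g.form v z = g.form w z) : v = w := by
  refine g.ext_form fun y => ?_
  have hy : y = Q.proj x y + g.form (Q.normal x) y • Q.normal x := by simp [Model.proj]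
  rw [Model.mem_tangent_iff, g.form_comm] at hv hw
  rw [hy, map_add, map_add, map_smul, map_smul, hv, hw, h _ (Q.proj_mem_tangent hx y)]

theorem form_raiseMap_pair {R : Tensor4 V} (hR : IsCurvature R) (a b c d : V) :
    g.form (raiseMap g R a b c) d = g.form (raiseMap g R c d a) b := by
  rw [form_raiseMap, form_raiseMap, hR.pair]

theorem form_raiseMap' {R : Tensor4 V} (hR : IsCurvature R) (a b c d : V) :
    g.form (raiseMap g R a b c) d = R ![c, b, a, d] := by
  rw [form_raiseMap, ← hR.pair, hR.antisymm_left, hR.antisymm_right, neg_neg]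

/-- A vector field on `M` near a point, with only first-order regularity. -/
structure IsTangentAt (Q : Model g) (U : Set V) (x : V) (X : V → V) : Prop where
  differentiableAt : DifferentiableAt ℝ X x
  tangent : ∀ y ∈ Q.patch U, X y ∈ Q.tangent y

theorem IsVectorField.isTangentAt {X : V → V} (hX : IsVectorField Q U X) (hU : IsOpen U) {x : V}
    (hx : x ∈ Q.patch U) : IsTangentAt Q U x X :=
  ⟨(hX.smooth.contDiffAt (hU.mem_nhds hx.1)).differentiableAt (by simp), hX.tangent⟩

theorem IsTangentAt.form_fderiv {X : V → V} {x : V} (hX : IsTangentAt Q U x X) (hU : IsOpen U)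
    (hx : x ∈ Q.patch U) {w : V} (hw : w ∈ Q.tangent x) :
    g.form (fderiv ℝ Q.normal x w) (X x) + g.form (Q.normal x) (fderiv ℝ X x w) = 0 := by
  have hn : DifferentiableAt ℝ Q.normal x := (Q.contDiff_normal.differentiable (by simp)) x
  have h1 : HasFDerivAt (fun y => g.formL (Q.normal y) (X y)) _ x :=
    (g.formL.hasFDerivAt.comp x hn.hasFDerivAt).clm_apply hX.differentiableAt.hasFDerivAt
  have h2 := Q.fderiv_eq_of_eqOn hU hx hw h1.differentiableAt (differentiableAt_const (0 : ℝ))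
    fun y hy => by
      have := hX.tangent y hy
      rwa [Model.mem_tangent_iff] at this
  rw [h1.fderiv] at h2
  simp at h2
  linarith

/-- The only differences between the two models that matter below: either the normal is the position
vector and ḡ = g, or the normal is constant and ḡ drops the normal component. -/
theorem Model.fderiv_normal_cases (Q : Model g) (x : V) :
    (Q.normal x = x ∧ (∀ w, fderiv ℝ Q.normal x w = w) ∧ ∀ a b, Q.gbarForm a b = g.form a b) ∨
      ((∀ w, fderiv ℝ Q.normal x w = 0) ∧
        ∀ a b, Q.gbarForm a b = g.form a b - g.form (Q.normal x) a * g.form (Q.normal x) b) := by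
  cases Q with
  | sphere =>
    refine Or.inl ⟨rfl, fun w => ?_, fun _ _ => rfl⟩
    change fderiv ℝ (fun y => y) x w = w
    simp
  | hyperplane u hu =>
    refine Or.inr ⟨fun w => ?_, fun a b => ?_⟩
    · change fderiv ℝ (fun _ => u) x w = 0
      simp
    · simp [Model.gbarForm, Model.normal]

/-- The normal component is the antisymmetric part of the second fundamental form, which is
symmetric. -/
theorem lieBracket_mem_tangent {X Y : V → V} {x : V} (hX : IsTangentAt Q U x X)
    (hY : IsTangentAt Q U x Y) (hU : IsOpen U) (hx : x ∈ Q.patch U) :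
    VectorField.lieBracket ℝ X Y x ∈ Q.tangent x := by
  have h₁ := hY.form_fderiv hU hx (hX.tangent x hx)
  have h₂ := hX.form_fderiv hU hx (hY.tangent x hx)
  rw [Model.mem_tangent_iff, VectorField.lieBracket, map_sub]
  have h₃ : g.form (fderiv ℝ Q.normal x (X x)) (Y x)
      = g.form (fderiv ℝ Q.normal x (Y x)) (X x) := by
    rcases Q.fderiv_normal_cases x with ⟨-, h, -⟩ | ⟨h, -⟩
    · rw [h, h, g.form_comm]
    · rw [h, h]; simp
  linarith

section Endo

variable {K : V → V →L[ℝ] V →L[ℝ] ℝ} {R : Tensor4 V}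

theorem form_endo {x z : V} (hz : z ∈ Q.tangent x) (v : V) :
    g.form (endo Q K x v) z = K x v z := by
  rw [endo, Q.form_proj_left hz, g.form_sharp]; rfl

theorem endo_mem_tangent {x : V} (hx : x ∈ Q.patch U) (v : V) : endo Q K x v ∈ Q.tangent x :=
  Q.proj_mem_tangent hx.2 _

theorem CorrespondsR.endo_eq (hR : CorrespondsR Q U K R) {x v : V} (hx : x ∈ Q.patch U)
    (hv : v ∈ Q.tangent x) : endo Q K x v = Q.proj x (raiseMap g R x v x) := by
  refine Model.ext_tangent hx.2 (endo_mem_tangent hx v) (Q.proj_mem_tangent hx.2 _)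
    fun z hz => ?_
  rw [form_endo hz, Q.form_proj_left hz, form_raiseMap' hR.1, hR.2 x hx v hv z hz]

theorem CorrespondsR.form_endo_comm (hR : CorrespondsR Q U K R) {x v w : V} (hx : x ∈ Q.patch U)
    (hv : v ∈ Q.tangent x) (hw : w ∈ Q.tangent x) :
    g.form (endo Q K x v) w = g.form v (endo Q K x w) := by
  rw [g.form_comm v, form_endo hw, form_endo hv, hR.2 x hx v hv w hw, hR.2 x hx w hw v hv,
    hR.1.pair]

theorem differentiableAt_endo {X : V → V} {x : V} (hK : ContDiffOn ℝ ∞ K U) (hU : IsOpen U)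
    (hx : x ∈ Q.patch U) (hX : DifferentiableAt ℝ X x) :
    DifferentiableAt ℝ (fun y => endo Q K y (X y)) x := by
  have hKx : DifferentiableAt ℝ K x :=
    (hK.contDiffAt (hU.mem_nhds hx.1)).differentiableAt (by simp)
  have hn : DifferentiableAt ℝ Q.normal x := (Q.contDiff_normal.differentiable (by simp)) x
  have hs : DifferentiableAt ℝ (fun y => g.sharpL (K y (X y))) x :=
    g.sharpL.differentiableAt.comp x (hKx.clm_apply hX)
  exact hs.sub (((g.formL.differentiableAt.comp x hn).clm_apply hs).smul hn)

theorem IsTangentAt.endo {X : V → V} {x : V} (hX : IsTangentAt Q U x X)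
    (hK : ContDiffOn ℝ ∞ K U) (hU : IsOpen U) (hx : x ∈ Q.patch U) :
    IsTangentAt Q U x (fun y => endo Q K y (X y)) :=
  ⟨differentiableAt_endo hK hU hx hX.differentiableAt, fun _ hy => endo_mem_tangent hy _⟩

/-- On M the field KX is the projection of T(y,X,y), so its derivative follows from the Leibniz rule
in the three slots. -/
theorem CorrespondsR.form_fderiv_endo (hR : CorrespondsR Q U K R) {X : V → V} {x w z : V}
    (hX : IsTangentAt Q U x X) (hK : ContDiffOn ℝ ∞ K U) (hU : IsOpen U) (hx : x ∈ Q.patch U)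
    (hw : w ∈ Q.tangent x) (hz : z ∈ Q.tangent x) :
    g.form (fderiv ℝ (fun y => KillingNijenhuis.endo Q K y (X y)) x w) z
      = g.form (raiseMap g R w (X x) x) z + g.form (raiseMap g R x (fderiv ℝ X x w) x) z
        + g.form (raiseMap g R x (X x) w) z := by
  have hn : DifferentiableAt ℝ Q.normal x := (Q.contDiff_normal.differentiable (by simp)) x
  set T := toCLM₃ (raiseMap g R) with hT
  have h1 : HasFDerivAt (fun y => T y (X y) y) _ x :=
    ((T.hasFDerivAt.clm_apply hX.differentiableAt.hasFDerivAt).clm_apply (hasFDerivAt_id x))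
  have h2 : HasFDerivAt (fun y => T y (X y) y - g.formL (Q.normal y) (T y (X y) y) • Q.normal y)
      _ x := h1.sub (((g.formL.hasFDerivAt.comp x hn.hasFDerivAt).clm_apply h1).smul
        hn.hasFDerivAt)
  have h3 := Q.fderiv_eq_of_eqOn hU hx hw (differentiableAt_endo hK hU hx hX.differentiableAt)
    h2.differentiableAt fun y hy => hR.endo_eq hy (hX.tangent y hy)
  have hz' := hz
  rw [Model.mem_tangent_iff] at hz'
  -- The derivative of the projection contributes nothing: on the sphere T(x,X,x) is orthogonal to
  -- the normal x by antisymmetry of R, and on the hyperplane the normal is constant.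
  have h4 : g.form (Q.normal x) (raiseMap g R x (X x) x) * g.form (fderiv ℝ Q.normal x w) z
      = 0 := by
    rcases Q.fderiv_normal_cases x with ⟨h, -, -⟩ | ⟨h, -⟩
    · rw [h, g.form_comm, form_raiseMap]
      have := hR.1.antisymm_left x x (X x) x
      rw [show R ![x, x, X x, x] = 0 by linarith, zero_mul]
    · rw [h]; simp
  rw [h3, h2.fderiv]
  simp [hT, hz', h4]
  ring

/-- The derivative of X need not be tangent. On the sphere T(x,z,x) is already tangent, so no
projection interferes; on the hyperplane the derivative of X is tangent. -/
theorem CorrespondsR.form_raiseMap_fderiv (hR : CorrespondsR Q U K R) {X : V → V} {x w z : V}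
    (hX : IsTangentAt Q U x X) (hU : IsOpen U) (hx : x ∈ Q.patch U)
    (hw : w ∈ Q.tangent x) (hz : z ∈ Q.tangent x) :
    g.form (raiseMap g R x (fderiv ℝ X x w) x) z
      = g.form (fderiv ℝ X x w) (KillingNijenhuis.endo Q K x z) := by
  have h1 := hX.form_fderiv hU hx hw
  rw [hR.endo_eq hx hz, Model.proj, map_sub, map_smul, form_raiseMap_pair hR.1,
    g.form_comm (fderiv ℝ X x w), g.form_comm (fderiv ℝ X x w)]
  rcases Q.fderiv_normal_cases x with ⟨h, -, -⟩ | ⟨h, -⟩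
  · have := hR.1.antisymm_left x x z x
    rw [h, g.form_comm x (raiseMap g R x z x), form_raiseMap, form_raiseMap,
      show R ![x, x, z, x] = 0 by linarith, zero_smul, sub_zero]
  · rw [h] at h1
    have h2 : g.form (Q.normal x) (fderiv ℝ X x w) = 0 := by simpa using h1
    rw [h2, smul_zero, sub_zero]

/-- Self-adjointness of K moves it onto z, after which all derivatives of X and Y cancel. The
coefficient 3 is 2 from the antisymmetry of T(x,X,Y) plus 1 from the Bianchi identity. -/
theorem CorrespondsR.form_nijenhuis (hR : CorrespondsR Q U K R) {X Y : V → V} {x z : V}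
    (hX : IsTangentAt Q U x X) (hY : IsTangentAt Q U x Y) (hK : ContDiffOn ℝ ∞ K U)
    (hU : IsOpen U) (hx : x ∈ Q.patch U) (hz : z ∈ Q.tangent x) :
    g.form (nijenhuis Q K X Y x) z
      = 3 * g.form (raiseMap g R x (X x) (Y x)) (KillingNijenhuis.endo Q K x z)
        + (g.form (raiseMap g R (KillingNijenhuis.endo Q K x (X x)) (Y x) x) z
          + g.form (raiseMap g R x (Y x) (KillingNijenhuis.endo Q K x (X x))) z)
        - (g.form (raiseMap g R (KillingNijenhuis.endo Q K x (Y x)) (X x) x) z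
          + g.form (raiseMap g R x (X x) (KillingNijenhuis.endo Q K x (Y x))) z) := by
  have tX := hX.tangent x hx
  have tY := hY.tangent x hx
  have hKX := hX.endo hK hU hx
  have hKY := hY.endo hK hU hx
  have tKX := hKX.tangent x hx
  have tKY := hKY.tangent x hx
  have tKz : KillingNijenhuis.endo Q K x z ∈ Q.tangent x := endo_mem_tangent hx z
  have b₁ := lieBracket_mem_tangent hX hY hU hx
  have b₂ := lieBracket_mem_tangent hKX hY hU hx
  have b₃ := lieBracket_mem_tangent hX hKY hU hx
  rw [nijenhuis]
  simp only [map_add, map_sub, LinearMap.add_apply, LinearMap.sub_apply]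
  rw [hR.form_endo_comm hx (endo_mem_tangent hx _) hz, hR.form_endo_comm hx b₁ tKz,
    hR.form_endo_comm hx b₂ hz, hR.form_endo_comm hx b₃ hz]
  simp only [VectorField.lieBracket, map_sub, LinearMap.sub_apply]
  rw [← hR.form_raiseMap_fderiv hY hU hx tX tKz, ← hR.form_raiseMap_fderiv hX hU hx tY tKz,
    hR.form_fderiv_endo hX hK hU hx tY tKz, hR.form_fderiv_endo hY hK hU hx tX tKz,
    hR.form_fderiv_endo hX hK hU hx tKY hz, hR.form_fderiv_endo hY hK hU hx tKX hz,
    hR.form_raiseMap_fderiv hX hU hx tKY hz, hR.form_raiseMap_fderiv hY hU hx tKX hz]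
  have hT := hR.1.isCurvatureMap g
  have e₁ := congrArg (fun v => g.form v (KillingNijenhuis.endo Q K x z))
    (hT.bianchi x (X x) (Y x))
  rw [hT.antisymm x (X x) (Y x), hT.antisymm (Y x) x (X x)]
  simp only [map_add, map_neg, LinearMap.add_apply, LinearMap.neg_apply, map_zero,
    LinearMap.zero_apply] at e₁ ⊢
  linarith

/-- This is where ḡ enters: Kz is the tangential part of T(x,z,x). On the sphere that vector is
tangent and g suffices, while on the hyperplane the u-component has to be removed. -/
theorem CorrespondsR.form_raiseMap_endo (hR : CorrespondsR Q U K R) {x z : V}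
    (hx : x ∈ Q.patch U) (hz : z ∈ Q.tangent x) (v : V) :
    g.form v (KillingNijenhuis.endo Q K x z) = Q.gbarForm (raiseMap g R x z x) v := by
  rw [hR.endo_eq hx hz, Model.proj, map_sub, map_smul, g.form_comm v, g.form_comm v, smul_eq_mul]
  rcases Q.fderiv_normal_cases x with ⟨h, -, h'⟩ | ⟨-, h'⟩
  · have := hR.1.antisymm_left x x z x
    rw [h', h, g.form_comm x (raiseMap g R x z x), form_raiseMap g R x z x x,
      show R ![x, x, z, x] = 0 by linarith, zero_mul, sub_zero]
  · rw [h']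

/-- By pair symmetry, the terms with KX in a slot of T are symmetric in Y and z, and likewise those
with KY in X and z. Alternation kills them, and only the coefficient-3 term remains, each cyclic
term occurring twice. -/
theorem CorrespondsR.sum_form_nijenhuis (hR : CorrespondsR Q U K R) {X : Fin 3 → V → V} {x : V}
    (hX : ∀ i, IsTangentAt Q U x (X i)) (hK : ContDiffOn ℝ ∞ K U) (hU : IsOpen U)
    (hx : x ∈ Q.patch U) :
    ∑ σ : Equiv.Perm (Fin 3), ((Equiv.Perm.sign σ : ℤ) : ℝ) *
      g.form (nijenhuis Q K (X (σ 0)) (X (σ 1)) x) (X (σ 2) x)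
      = 6 * curvCubic Q.gbarForm (raiseMap g R) x (X 0 x) (X 1 x) (X 2 x) := by
  rw [sum_sign_perm_fin_three fun i j k => g.form (nijenhuis Q K (X i) (X j) x) (X k x)]
  have t := fun i => (hX i).tangent x hx
  have hT := hR.1.isCurvatureMap g
  simp only [hR.form_nijenhuis (hX _) (hX _) hK hU hx (t _), hR.form_raiseMap_endo hx (t _)]
  rw [curvCubic, hT.antisymm x (X 1 x) (X 0 x), hT.antisymm x (X 2 x) (X 0 x),
    hT.antisymm x (X 2 x) (X 1 x)]
  have s := fun i j k => form_raiseMap_pair (g := g) hR.1 x (X i x)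
    (KillingNijenhuis.endo Q K x (X j x)) (X k x)
  have s₁ := s 0 1 2
  have s₂ := s 0 2 1
  have s₃ := s 1 0 2
  have s₄ := s 1 2 0
  have s₅ := s 2 0 1
  have s₆ := s 2 1 0
  simp only [map_neg] at *
  linarith

end Endo

end

section

/-! ### From the model to the ambient space -/

theorem exists_segment_subset {C : Set V} (hC : IsOpen C) {x : V} (hx : x ∈ C) (v : V) :
    ∃ δ : ℝ, 0 < δ ∧ ∀ s : ℝ, |s| ≤ 2 * δ → x + s • v ∈ C := by
  have hc : ContinuousAt (fun s : ℝ => x + s • v) 0 := by fun_prop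
  have hm : (fun s : ℝ => x + s • v) ⁻¹' C ∈ nhds (0 : ℝ) :=
    hc.preimage_mem_nhds (hC.mem_nhds (by simpa using hx))
  obtain ⟨ε, hε, h⟩ := Metric.mem_nhds_iff.1 hm
  refine ⟨ε / 3, by positivity, fun s hs => h ?_⟩
  rw [Metric.mem_ball, Real.dist_eq, sub_zero]
  linarith

theorem curvCubic_cycle (β : LinearMap.BilinForm ℝ V) (T : V →ₗ[ℝ] V →ₗ[ℝ] V →ₗ[ℝ] V)
    (x p q r : V) : curvCubic β T x q r p = curvCubic β T x p q r := by
  rw [curvCubic, curvCubic]; ring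

theorem curvCubic_eq_zero_of_isOpen {β : LinearMap.BilinForm ℝ V}
    {T : V →ₗ[ℝ] V →ₗ[ℝ] V →ₗ[ℝ] V} {C : Set V} (hC : IsOpen C) (hne : C.Nonempty) {p q r : V}
    (h : ∀ x ∈ C, curvCubic β T x p q r = 0) (x : V) : curvCubic β T x p q r = 0 := by
  obtain ⟨x₀, hx₀⟩ := hne
  obtain ⟨δ, hδ, hseg⟩ := exists_segment_subset hC hx₀ x
  have h₀ := h _ hx₀
  have h₁ := h _ (hseg δ (by rw [abs_of_pos hδ]; linarith))
  have h₂ := h _ (hseg (-δ) (by rw [abs_neg, abs_of_pos hδ]; linarith))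
  have h₃ := h _ (hseg (2 * δ) (by rw [abs_of_pos (by positivity)]))
  have h₄ := h _ (hseg (-(2 * δ)) (by rw [abs_neg, abs_of_pos (by positivity)]))
  -- A finite difference along x₀ + s·x that isolates the s³ coefficient of the cubic, which is its
  -- value at x.
  have key : 12 * δ ^ 3 * curvCubic β T x p q r = 0 := by
    simp only [curvCubic, map_add, map_smul, LinearMap.add_apply, LinearMap.smul_apply,
      smul_eq_mul] at *
    linear_combination h₃ - h₄ - 2 * h₁ + 2 * h₂
  exact (mul_eq_zero.1 key).resolve_left (by positivity)

variable {g : InnerProd V} {Q : Model g} {U : Set V}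

/-- The tangential component of `v` along the position vector. -/
theorem Model.sub_smul_mem_tangent (Q : Model g) {x : V} (hx : x ∈ Q.carrier) (v : V) :
    v - g.form (Q.normal x) v • x ∈ Q.tangent x := by
  rw [Model.mem_tangent_iff, map_sub, map_smul, Q.form_normal_self hx]
  simp

theorem isVectorField_proj (Q : Model g) (U : Set V) (v : V) :
    IsVectorField Q U (fun y => Q.proj y v) where
  smooth := by
    refine ContDiff.contDiffOn (contDiff_const.sub (ContDiff.smul ?_ Q.contDiff_normal))
    exact (g.formL.contDiff.comp Q.contDiff_normal).clm_apply contDiff_const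
  tangent x hx := Q.proj_mem_tangent hx.2 v

theorem CorrespondsR.firstNijenhuis_iff {K : V → V →L[ℝ] V →L[ℝ] ℝ} {R : Tensor4 V}
    (hR : CorrespondsR Q U K R) (hK : ContDiffOn ℝ ∞ K U) (hU : IsOpen U)
    (hM : (Q.patch U).Nonempty) :
    FirstNijenhuis Q U K ↔ ∀ x p q r, curvCubic Q.gbarForm (raiseMap g R) x p q r = 0 := by
  have hT := hR.1.isCurvatureMap g
  constructor
  · intro h
    have e₁ : ∀ x ∈ Q.patch U, ∀ p ∈ Q.tangent x, ∀ q ∈ Q.tangent x, ∀ r ∈ Q.tangent x,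
        curvCubic Q.gbarForm (raiseMap g R) x p q r = 0 := by
      intro x hx p hp q hq r hr
      have hX : ∀ i : Fin 3, IsVectorField Q U (fun y => Q.proj y (![p, q, r] i)) :=
        fun i => isVectorField_proj Q U _
      have e := h (fun i y => Q.proj y (![p, q, r] i)) hX x hx
      rw [hR.sum_form_nijenhuis (fun i => (hX i).isTangentAt hU hx) hK hU hx] at e
      have hp' : Q.proj x (![p, q, r] 0) = p := Q.proj_eq_self hp
      have hq' : Q.proj x (![p, q, r] 1) = q := Q.proj_eq_self hq
      have hr' : Q.proj x (![p, q, r] 2) = r := Q.proj_eq_self hr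
      rw [hp', hq', hr'] at e
      linarith
    -- Any p differs from a tangent vector by a multiple of x, and the form vanishes at p = x.
    -- Cyclic invariance then frees the three arguments in turn.
    have ext : ∀ x ∈ Q.patch U, ∀ q r,
        (∀ p ∈ Q.tangent x, curvCubic Q.gbarForm (raiseMap g R) x p q r = 0) →
        ∀ p, curvCubic Q.gbarForm (raiseMap g R) x p q r = 0 := by
      intro x hx q r h p
      have h₁ := h _ (Q.sub_smul_mem_tangent hx.2 p)
      have h₂ := curvCubic_self Q.gbarForm_comm hT x q r
      simp only [curvCubic, map_sub, map_smul, LinearMap.sub_apply, LinearMap.smul_apply,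
        smul_eq_mul] at h₁ h₂ ⊢
      linear_combination h₁ + g.form (Q.normal x) p * h₂
    have e₂ : ∀ x ∈ Q.patch U, ∀ p q r, curvCubic Q.gbarForm (raiseMap g R) x p q r = 0 := by
      intro x hx p q r
      refine ext x hx q r (fun p hp => ?_) p
      rw [← curvCubic_cycle]
      refine ext x hx r p (fun q hq => ?_) q
      rw [← curvCubic_cycle]
      exact ext x hx p q (fun r hr => e₁ x hx r hr p hp q hq) r
    have e₃ : ∀ x ∈ Q.cone U, ∀ p q r, curvCubic Q.gbarForm (raiseMap g R) x p q r = 0 := by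
      intro x hx p q r
      have e := e₂ _ (Q.retract_mem_patch hx) p q r
      rw [← Q.radius_smul_retract hx.1]
      simp only [curvCubic, map_smul, LinearMap.smul_apply, smul_eq_mul] at e ⊢
      linear_combination Q.radius x ^ 3 * e
    intro x p q r
    exact curvCubic_eq_zero_of_isOpen (Q.isOpen_cone hU) (hM.mono fun _ => Q.mem_cone)
      (fun y hy => e₃ y hy p q r) x
  · intro h X hX x hx
    rw [hR.sum_form_nijenhuis (fun i => (hX i).isTangentAt hU hx) hK hU hx, h, mul_zero]

/-! ### Uniqueness of the algebraic curvature tensor -/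

theorem tensor4_ext {R R' : Tensor4 V} (h : ∀ a b c d, R ![a, b, c, d] = R' ![a, b, c, d]) :
    R = R' := by
  ext v
  have hv : v = ![v 0, v 1, v 2, v 3] := by
    funext i; fin_cases i <;> rfl
  rw [hv]
  exact h _ _ _ _

theorem IsCurvature.sub {R R' : Tensor4 V} (hR : IsCurvature R) (hR' : IsCurvature R') :
    IsCurvature (R - R') where
  antisymm_left a b c d := by
    rw [sub_apply, sub_apply, hR.antisymm_left, hR'.antisymm_left]; ring
  antisymm_right a b c d := by
    rw [sub_apply, sub_apply, hR.antisymm_right, hR'.antisymm_right]; ring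
  pair a b c d := by
    rw [sub_apply, sub_apply, hR.pair, hR'.pair]
  bianchi a b c d := by
    have h := hR.bianchi a b c d
    have h' := hR'.bianchi a b c d
    simp only [sub_apply]
    linarith

/-- Polarisation makes R antisymmetric in its first and third slots, hence alternating in the last
three. The Bianchi identity then reads 3R = 0. -/
theorem IsCurvature.eq_zero_of_diag {R : Tensor4 V} (g : InnerProd V) (hR : IsCurvature R)
    (h : ∀ y v w, R ![y, v, y, w] = 0) : R = 0 := by
  have hs : ∀ a b c d, R ![c, b, a, d] = -R ![a, b, c, d] := by
    intro a b c d
    have e := h (a + c) b d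
    have e₁ := h a b d
    have e₂ := h c b d
    rw [← form_raiseMap' (g := g) hR] at e e₁ e₂
    rw [← form_raiseMap' (g := g) hR, ← form_raiseMap' (g := g) hR]
    simp only [map_add, LinearMap.add_apply] at e
    linarith
  refine tensor4_ext fun a b c d => ?_
  have h₁ := hR.bianchi a b c d
  have h₂ : ∀ b c d, R ![a, c, b, d] = -R ![a, b, c, d] := fun b c d => by
    rw [hR.antisymm_left c, hs b, hR.antisymm_left a, neg_neg]
  rw [hR.antisymm_right a c b d, h₂ b c d, h₂ b d c, hR.antisymm_right a b c d] at h₁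
  rw [zero_apply]
  linarith

/-- Tangency of v and w is dropped since the expression vanishes when either is x. Homogeneity
passes to the open cone, and a second difference isolates the quadratic term. -/
theorem IsCurvature.eq_zero_of_tangent {R : Tensor4 V} (hR : IsCurvature R) (hU : IsOpen U)
    (hM : (Q.patch U).Nonempty)
    (h : ∀ x ∈ Q.patch U, ∀ v ∈ Q.tangent x, ∀ w ∈ Q.tangent x, R ![x, v, x, w] = 0) : R = 0 := by
  simp only [← form_raiseMap' (g := g) hR] at h
  have h₁ : ∀ x ∈ Q.patch U, ∀ v w, g.form (raiseMap g R x v x) w = 0 := by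
    intro x hx v w
    have e := h x hx _ (Q.sub_smul_mem_tangent hx.2 v) _ (Q.sub_smul_mem_tangent hx.2 w)
    have e₁ : raiseMap g R x x x = 0 := (hR.isCurvatureMap g).self x x
    have e₂ : ∀ v, g.form (raiseMap g R x v x) x = 0 := fun v => by
      rw [form_raiseMap]
      have := hR.antisymm_left x x v x
      linarith
    simpa [e₁, e₂] using e
  refine hR.eq_zero_of_diag g fun y v w => ?_
  obtain ⟨x, hx⟩ := hM
  obtain ⟨δ, hδ, hseg⟩ := exists_segment_subset (Q.isOpen_cone hU) (Q.mem_cone hx) y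
  have h₂ : ∀ y ∈ Q.cone U, g.form (raiseMap g R y v y) w = 0 := by
    intro y hy
    have e := h₁ _ (Q.retract_mem_patch hy) v w
    rw [← Q.radius_smul_retract hy.1]
    simp [e]
  have k₀ := h₂ _ (Q.mem_cone hx)
  have k₁ := h₂ _ (hseg δ (by rw [abs_of_pos hδ]; linarith))
  have k₂ := h₂ _ (hseg (-δ) (by rw [abs_neg, abs_of_pos hδ]; linarith))
  have key : 2 * δ ^ 2 * g.form (raiseMap g R y v y) w = 0 := by
    simp only [map_add, map_smul, LinearMap.add_apply, LinearMap.smul_apply,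
      smul_eq_mul] at *
    linear_combination k₁ + k₂ - 2 * k₀
  rw [← form_raiseMap' (g := g) hR]
  exact (mul_eq_zero.1 key).resolve_left (by positivity)

theorem CorrespondsR.unique {K : V → V →L[ℝ] V →L[ℝ] ℝ} {R R' : Tensor4 V} (hU : IsOpen U)
    (hM : (Q.patch U).Nonempty) (hR : CorrespondsR Q U K R) (hR' : CorrespondsR Q U K R') :
    R = R' := by
  refine sub_eq_zero.1 ((hR.1.sub hR'.1).eq_zero_of_tangent hU hM fun x hx v hv w hw => ?_)
  rw [sub_apply, ← hR.2 x hx v hv w hw, ← hR'.2 x hx v hv w hw, sub_self]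

theorem CorrespondsS.correspondsR {K : V → V →L[ℝ] V →L[ℝ] ℝ} {S : Tensor4 V}
    (hS : CorrespondsS Q U K S) : CorrespondsR Q U K (toCurvature S) := by
  refine ⟨hS.1.toCurvature, fun x hx v hv w hw => ?_⟩
  rw [hS.2 x hx v hv w hw, hS.1.eq_toCurvature, hS.1.toCurvature.pair x w]
  ring

theorem CorrespondsS.unique {K : V → V →L[ℝ] V →L[ℝ] ℝ} {S S' : Tensor4 V} (hU : IsOpen U)
    (hM : (Q.patch U).Nonempty) (hS : CorrespondsS Q U K S) (hS' : CorrespondsS Q U K S') :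
    S = S' := by
  have h := hS.correspondsR.unique hU hM hS'.correspondsR
  refine tensor4_ext fun a b c d => ?_
  rw [hS.1.eq_toCurvature, hS'.1.eq_toCurvature, h]

end

/-! ### Killing tensors in flat space -/

/-- Meant for the third derivatives of a flat Killing tensor, with derivative slots a, b, c. It
expresses injectivity of the symmetrisation S³ ⊗ S² → S² ⊗ S³; the proof shifts a repeated argument
x step by step from the last three slots into the first three. -/
theorem eq_zero_of_cyclic {W : Type*} [AddCommGroup W] (t : W → W → W → W → W → ℝ)
    (hadd : ∀ a a' b c v w, t (a + a') b c v w = t a b c v w + t a' b c v w)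
    (h₁₂ : ∀ a b c v w, t b a c v w = t a b c v w)
    (h₂₃ : ∀ a b c v w, t a c b v w = t a b c v w)
    (h₄₅ : ∀ a b c v w, t a b c w v = t a b c v w)
    (hcyc : ∀ a b c v w, t a b c v w + t a b v w c + t a b w c v = 0) (a b c v w : W) :
    t a b c v w = 0 := by
  refine eq_zero_of_symmetric_of_diag (fun a b c => t a b c v w) (fun _ _ _ _ => hadd _ _ _ _ _ _)
    (fun _ _ _ => h₁₂ _ _ _ _ _) (fun _ _ _ => h₂₃ _ _ _ _ _) (fun x => ?_) a b c
  have h0 : ∀ v w, t x v w x x = 0 := fun v w => by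
    have := hcyc v w x x x
    rw [h₁₂ v x w, h₂₃ v w x]
    linarith
  have h1 : ∀ v w, t x x v w x = 0 := fun v w => by
    have e := hcyc x v x w x
    rw [h0, h₂₃ x x v, h₂₃ x x v, h₄₅ x x v w x] at e
    linarith
  have e := hcyc x x x v w
  rw [h1, h₄₅ x x w v x, h1] at e
  linarith

/-- The directional derivative of a scalar function. -/
def dirDeriv (a : V) (f : V → ℝ) (y : V) : ℝ := fderiv ℝ f y a

section DirDeriv

variable {C : Set V} {f h k : V → ℝ}

theorem dirDeriv_add_left (a b : V) (f : V → ℝ) (y : V) :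
    dirDeriv (a + b) f y = dirDeriv a f y + dirDeriv b f y := map_add _ _ _

theorem dirDeriv_smul_left (c : ℝ) (a : V) (f : V → ℝ) (y : V) :
    dirDeriv (c • a) f y = c * dirDeriv a f y := map_smul _ _ _

theorem contDiffOn_dirDeriv (hC : IsOpen C) (hf : ContDiffOn ℝ ∞ f C) (a : V) :
    ContDiffOn ℝ ∞ (dirDeriv a f) C :=
  (hf.fderiv_of_isOpen hC (by simp)).clm_apply contDiffOn_const

theorem differentiableAt_of_contDiffOn {E : Type*} [NormedAddCommGroup E] [NormedSpace ℝ E]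
    {f : V → E} (hC : IsOpen C) (hf : ContDiffOn ℝ ∞ f C) {y : V} (hy : y ∈ C) :
    DifferentiableAt ℝ f y :=
  (hf.contDiffAt (hC.mem_nhds hy)).differentiableAt (by simp)

theorem dirDeriv_congr (hC : IsOpen C) (hfh : Set.EqOn f h C) (a : V) :
    Set.EqOn (dirDeriv a f) (dirDeriv a h) C := fun y hy => by
  rw [dirDeriv, (hfh.eventuallyEq_of_mem (hC.mem_nhds hy)).fderiv_eq, dirDeriv]

theorem dirDeriv_add (hC : IsOpen C) (hf : ContDiffOn ℝ ∞ f C) (hh : ContDiffOn ℝ ∞ h C) (a : V) :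
    Set.EqOn (dirDeriv a (fun y => f y + h y)) (fun y => dirDeriv a f y + dirDeriv a h y) C :=
  fun y hy => by
    simp only [dirDeriv]
    rw [fderiv_fun_add (differentiableAt_of_contDiffOn hC hf hy)
      (differentiableAt_of_contDiffOn hC hh hy), add_apply]

theorem dirDeriv_const_mul (hC : IsOpen C) (hf : ContDiffOn ℝ ∞ f C) (c : ℝ) (a : V) :
    Set.EqOn (dirDeriv a (fun y => c * f y)) (fun y => c * dirDeriv a f y) C :=
  fun y hy => by
    simp only [dirDeriv]
    rw [fderiv_const_mul (differentiableAt_of_contDiffOn hC hf hy), smul_apply, smul_eq_mul]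

theorem dirDeriv_dirDeriv (hC : IsOpen C) (hf : ContDiffOn ℝ ∞ f C) (a b : V) {y : V}
    (hy : y ∈ C) : dirDeriv a (dirDeriv b f) y = fderiv ℝ (fderiv ℝ f) y a b := by
  have h := differentiableAt_of_contDiffOn hC (hf.fderiv_of_isOpen hC (by simp) : ContDiffOn ℝ ∞
    (fderiv ℝ f) C) hy
  have h' := h.hasFDerivAt.clm_apply (hasFDerivAt_const b y)
  change fderiv ℝ (fun z => fderiv ℝ f z b) y a = _
  rw [h'.fderiv]
  simp

theorem dirDeriv_comm (hC : IsOpen C) (hf : ContDiffOn ℝ ∞ f C) (a b : V) :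
    Set.EqOn (dirDeriv a (dirDeriv b f)) (dirDeriv b (dirDeriv a f)) C := fun y hy => by
  rw [dirDeriv_dirDeriv hC hf a b hy, dirDeriv_dirDeriv hC hf b a hy]
  exact (hf.contDiffAt (hC.mem_nhds hy)).isSymmSndFDerivAt
    (by rw [minSmoothness_of_isRCLikeNormedField]; exact
      WithTop.coe_le_coe.2 (le_top : (2 : ℕ∞) ≤ ⊤)) a b

theorem dirDeriv_sum_eq_zero (hC : IsOpen C) (hf : ContDiffOn ℝ ∞ f C) (hh : ContDiffOn ℝ ∞ h C)
    (hk : ContDiffOn ℝ ∞ k C) (h0 : ∀ y ∈ C, f y + h y + k y = 0) (a : V) :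
    ∀ y ∈ C, dirDeriv a f y + dirDeriv a h y + dirDeriv a k y = 0 := fun y hy => by
  have e := dirDeriv_congr hC (f := fun y => f y + h y + k y) (h := fun _ => 0) h0 a hy
  rw [dirDeriv_add hC (hf.add hh) hk a hy] at e
  simp only [dirDeriv_add hC hf hh a hy] at e
  rw [e]
  simp [dirDeriv]

/-- Differentiating Euler's relation at y along y gives D²f(y,y) + Df(y) = 2Df(y), so D²f(y,y) =
Df(y) = 2f(y). -/
theorem dirDeriv_self_of_euler (hC : IsOpen C) (hf : ContDiffOn ℝ ∞ f C)
    (he : ∀ y ∈ C, dirDeriv y f y = 2 * f y) {y : V} (hy : y ∈ C) :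
    dirDeriv y (dirDeriv y f) y = 2 * f y := by
  have h := differentiableAt_of_contDiffOn hC (hf.fderiv_of_isOpen hC (by simp) : ContDiffOn ℝ ∞
    (fderiv ℝ f) C) hy
  have h' := h.hasFDerivAt.clm_apply (hasFDerivAt_id y)
  have e := dirDeriv_congr hC (f := fun z => fderiv ℝ f z (id z)) (h := fun z => 2 * f z) he y hy
  rw [dirDeriv_const_mul hC hf 2 y hy, dirDeriv, h'.fderiv] at e
  beta_reduce at e
  rw [he y hy] at e
  have e' := he y hy
  rw [dirDeriv_dirDeriv hC hf y y hy]
  rw [dirDeriv] at e'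
  simp [e'] at e
  linarith

end DirDeriv

/-- A tensor from a quadrilinear function symmetric in its first and in its last two arguments. -/
def tensorOfSymm (B : V → V → V → V → ℝ)
    (add₁ : ∀ a a' b c d, B (a + a') b c d = B a b c d + B a' b c d)
    (smul₁ : ∀ (r : ℝ) a b c d, B (r • a) b c d = r * B a b c d)
    (add₃ : ∀ a b c c' d, B a b (c + c') d = B a b c d + B a b c' d)
    (smul₃ : ∀ (r : ℝ) a b c d, B a b (r • c) d = r * B a b c d)
    (symm₁ : ∀ a b c d, B a b c d = B b a c d) (symm₂ : ∀ a b c d, B a b c d = B a b d c) :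
    Tensor4 V :=
  MultilinearMap.mk' (fun m => B (m 0) (m 1) (m 2) (m 3))
    (fun m i x y => by
      fin_cases i
      · simp [add₁]
      · simp [symm₁ (m 0), add₁]
      · simp [add₃]
      · simp [symm₂ (m 0) (m 1) (m 2), add₃])
    (fun m i c x => by
      fin_cases i
      · simp [smul₁]
      · simp [symm₁ (m 0), smul₁]
      · simp [smul₃]
      · simp [symm₂ (m 0) (m 1) (m 2), smul₃])

/-- A Killing tensor on a connected open set that is homogeneous of degree two comes from a
symmetrised algebraic curvature tensor. -/
theorem exists_symCurvature_of_killing {C : Set V} (hC : IsOpen C) (hpre : IsPreconnected C)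
    (hne : C.Nonempty) {f : V → V → V → ℝ} (hf : ∀ v w, ContDiffOn ℝ ∞ (f v w) C)
    (hadd : ∀ v v' w y, f (v + v') w y = f v w y + f v' w y)
    (hsmul : ∀ (c : ℝ) v w y, f (c • v) w y = c * f v w y)
    (hsymm : ∀ v w, Set.EqOn (f v w) (f w v) C)
    (hkill : ∀ y ∈ C, ∀ v, dirDeriv v (f v v) y = 0)
    (heuler : ∀ y ∈ C, ∀ v w, dirDeriv y (f v w) y = 2 * f v w y) :
    ∃ S : Tensor4 V, IsSymCurvature S ∧ ∀ y ∈ C, ∀ v w, f v w y = S ![y, y, v, w] := by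
  have hf₁ : ∀ a v w, ContDiffOn ℝ ∞ (dirDeriv a (f v w)) C :=
    fun a v w => contDiffOn_dirDeriv hC (hf v w) a
  have hf₂ : ∀ b a v w, ContDiffOn ℝ ∞ (dirDeriv b (dirDeriv a (f v w))) C :=
    fun b a v w => contDiffOn_dirDeriv hC (hf₁ a v w) b
  have s₁ : ∀ a v w, Set.EqOn (dirDeriv a (f v w)) (dirDeriv a (f w v)) C :=
    fun a v w => dirDeriv_congr hC (hsymm v w) a
  have s₂ : ∀ b a v w, Set.EqOn (dirDeriv b (dirDeriv a (f v w))) (dirDeriv b (dirDeriv a (f w v)))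
    C := fun b a v w => dirDeriv_congr hC (s₁ a v w) b
  have add₁ : ∀ a v v' w, Set.EqOn (dirDeriv a (f (v + v') w))
      (fun y => dirDeriv a (f v w) y + dirDeriv a (f v' w) y) C := fun a v v' w =>
    (dirDeriv_congr hC (fun y _ => hadd v v' w y) a).trans (dirDeriv_add hC (hf v w) (hf v' w) a)
  have add₂ : ∀ b a v v' w, Set.EqOn (dirDeriv b (dirDeriv a (f (v + v') w)))
      (fun y => dirDeriv b (dirDeriv a (f v w)) y + dirDeriv b (dirDeriv a (f v' w)) y) C :=
    fun b a v v' w => (dirDeriv_congr hC (add₁ a v v' w) b).trans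
      (dirDeriv_add hC (hf₁ a v w) (hf₁ a v' w) b)
  have smul₂ : ∀ (c : ℝ) b a v w, Set.EqOn (dirDeriv b (dirDeriv a (f (c • v) w)))
      (fun y => c * dirDeriv b (dirDeriv a (f v w)) y) C := fun c b a v w =>
    (dirDeriv_congr hC ((dirDeriv_congr hC (fun y _ => hsmul c v w y) a).trans
      (dirDeriv_const_mul hC (hf v w) c a)) b).trans (dirDeriv_const_mul hC (hf₁ a v w) c b)
  have c₁ : ∀ a v w, ∀ y ∈ C,
      dirDeriv a (f v w) y + dirDeriv v (f w a) y + dirDeriv w (f a v) y = 0 := by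
    intro a v w y hy
    refine eq_zero_of_symmetric_of_diag
      (fun a v w => dirDeriv a (f v w) y + dirDeriv v (f w a) y + dirDeriv w (f a v) y)
      ?_ ?_ ?_ ?_ a v w
    · intro x x' z z'
      rw [dirDeriv_add_left, s₁ z z' (x + x') hy, s₁ z z' x hy, s₁ z z' x' hy,
        add₁ z x x' z' hy, add₁ z' x x' z hy]
      ring
    · intro x z z'
      rw [s₁ z x z' hy, s₁ x z' z hy, s₁ z' z x hy]
      ring
    · intro x z z'
      rw [s₁ x z' z hy, s₁ z' z x hy, s₁ z x z' hy]
      ring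
    · intro x
      simp [hkill y hy x]
  have c₂ : ∀ b a v w, ∀ y ∈ C, dirDeriv b (dirDeriv a (f v w)) y
      + dirDeriv b (dirDeriv v (f w a)) y + dirDeriv b (dirDeriv w (f a v)) y = 0 :=
    fun b a v w => dirDeriv_sum_eq_zero hC (hf₁ _ _ _) (hf₁ _ _ _) (hf₁ _ _ _) (c₁ a v w) b
  have z₃ : ∀ c b a v w, ∀ y ∈ C, dirDeriv c (dirDeriv b (dirDeriv a (f v w))) y = 0 := by
    intro c b a v w y hy
    exact eq_zero_of_cyclic (fun c b a v w => dirDeriv c (dirDeriv b (dirDeriv a (f v w))) y)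
      (fun _ _ _ _ _ _ => dirDeriv_add_left _ _ _ _)
      (fun c b a v w => dirDeriv_comm hC (hf₁ a v w) b c hy)
      (fun c b a v w => dirDeriv_congr hC (dirDeriv_comm hC (hf v w) a b) c hy)
      (fun c b a v w => dirDeriv_congr hC (s₂ b a w v) c hy)
      (fun c b a v w => dirDeriv_sum_eq_zero hC (hf₂ _ _ _ _) (hf₂ _ _ _ _) (hf₂ _ _ _ _)
        (c₂ b a v w) c y hy) c b a v w
  obtain ⟨x, hx⟩ := hne
  have hconst : ∀ b a v w, ∀ y ∈ C,
      dirDeriv b (dirDeriv a (f v w)) y = dirDeriv b (dirDeriv a (f v w)) x := fun b a v w y hy =>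
    hC.is_const_of_fderiv_eq_zero hpre
      (fun z hz => (differentiableAt_of_contDiffOn hC (hf₂ b a v w) hz).differentiableWithinAt)
      (fun z hz => ContinuousLinearMap.ext fun c => z₃ c b a v w z hz) hy hx
  -- The factor 1/2 matches D²f(y,y) = 2f(y) for functions homogeneous of degree two.
  let B : V → V → V → V → ℝ := fun b a v w => 1 / 2 * dirDeriv b (dirDeriv a (f v w)) x
  have sl : ∀ a b v w, B a b v w = B b a v w := fun a b v w => by
    simp only [B, dirDeriv_comm hC (hf v w) a b hx]
  have sr : ∀ a b v w, B a b v w = B a b w v := fun a b v w => by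
    simp only [B, s₂ a b v w hx]
  have hc : ∀ a b v w, B a b v w + B a v w b + B a w b v = 0 := fun a b v w => by
    simp only [B]
    linear_combination 1 / 2 * c₂ a b v w x hx
  refine ⟨tensorOfSymm B ?_ ?_ ?_ ?_ sl sr, ?_, ?_⟩
  · intro a a' b c d
    simp only [B, dirDeriv_add_left]; ring
  · intro r a b c d
    simp only [B, dirDeriv_smul_left]; ring
  · intro a b c c' d
    simp only [B, add₂ a b c c' d hx]; ring
  · intro r a b c d
    simp only [B, smul₂ r a b c d hx]; ring
  · refine ⟨fun a b c d => sl _ _ _ _, fun a b c d => sr _ _ _ _, fun a b c d => ?_,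
      fun a b c d => ?_⟩
    -- The mixed terms in the sums of the first two and of the last two cyclic identities coincide,
    -- which leaves 2B(a,b,c,d) = 2B(c,d,a,b).
    · change B c d a b = B a b c d
      have h₁ := hc a b c d
      have h₂ := hc b a c d
      have h₃ := hc c d a b
      have h₄ := hc d c a b
      linarith [sl b a c d, sl d c a b, sl c a b d, sr a c b d, sl d a b c, sl c b d a,
        sl d b c a, sr b d c a]
    · change B a b c d + B a d b c + B a c d b = 0
      linarith [hc a b c d]
  · intro y hy v w
    change f v w y = B y y v w
    simp only [B]
    rw [← hconst y y v w y hy, dirDeriv_self_of_euler hC (hf v w) (fun z hz => heuler z hz v w) hy]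
    ring

/-! ### Killing tensors on the model -/

variable {g : InnerProd V} {Q : Model g} {U : Set V} {K : V → V →L[ℝ] V →L[ℝ] ℝ}

/-- The projection onto the tangent space along the position vector. -/
def Model.radialProj (Q : Model g) (x : V) : V →L[ℝ] V :=
  ContinuousLinearMap.id ℝ V - (g.formL (Q.normal x)).smulRight x

theorem Model.radialProj_apply (Q : Model g) (x v : V) :
    Q.radialProj x v = v - g.form (Q.normal x) v • x := rfl

theorem Model.radialProj_mem_tangent (Q : Model g) {x : V} (hx : x ∈ Q.carrier) (v : V) :
    Q.radialProj x v ∈ Q.tangent x := Q.sub_smul_mem_tangent hx v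

theorem Model.radialProj_self (Q : Model g) {x : V} (hx : x ∈ Q.carrier) :
    Q.radialProj x x = 0 := by
  rw [Q.radialProj_apply, Q.form_normal_self hx, one_smul, sub_self]

theorem Model.radialProj_eq_self (Q : Model g) {x v : V} (hv : v ∈ Q.tangent x) :
    Q.radialProj x v = v := by
  rw [Model.mem_tangent_iff] at hv
  rw [Q.radialProj_apply, hv, zero_smul, sub_zero]

theorem Model.contDiff_radialProj (Q : Model g) (v : V) :
    ContDiff ℝ ∞ (fun x => Q.radialProj x v) :=
  contDiff_const.sub (((g.formL.contDiff.comp Q.contDiff_normal).clm_apply contDiff_const).smul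
    contDiff_id)

/-- The components of the homogeneous extension of degree two of `K` to the cone over `M`. -/
def coneExtension (Q : Model g) (K : V → V →L[ℝ] V →L[ℝ] ℝ) (v w y : V) : ℝ :=
  Q.radius y ^ 2 * K (Q.retract y) (Q.radialProj (Q.retract y) v) (Q.radialProj (Q.retract y) w)

theorem coneExtension_of_mem {x v w : V} (hx : x ∈ Q.carrier) (hv : v ∈ Q.tangent x)
    (hw : w ∈ Q.tangent x) : coneExtension Q K v w x = K x v w := by
  rw [coneExtension, Q.radius_eq_one hx, Q.retract_eq_self hx, Q.radialProj_eq_self hv,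
    Q.radialProj_eq_self hw, one_pow, one_mul]

theorem coneExtension_add (v v' w y : V) :
    coneExtension Q K (v + v') w y = coneExtension Q K v w y + coneExtension Q K v' w y := by
  simp [coneExtension, mul_add]

theorem coneExtension_smul (c : ℝ) (v w y : V) :
    coneExtension Q K (c • v) w y = c * coneExtension Q K v w y := by
  simp only [coneExtension, map_smul, smul_apply, smul_eq_mul]
  ring

theorem coneExtension_self {y : V} (hy : y ∈ Q.cone U) (w : V) :
    coneExtension Q K y w y = 0 := by
  have h : Q.radialProj (Q.retract y) y = 0 := by
    nth_rw 2 [← Q.radius_smul_retract hy.1]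
    rw [map_smul, Q.radialProj_self (Q.retract_mem_carrier hy.1), smul_zero]
  rw [coneExtension, h]
  simp

theorem coneExtension_smul_point {t : ℝ} (ht : 0 < t) (v w y : V) :
    coneExtension Q K v w (t • y) = t ^ 2 * coneExtension Q K v w y := by
  rw [coneExtension, coneExtension, Q.radius_smul ht, Q.retract_smul ht]
  ring

theorem contDiffOn_coneExtension (hK : ContDiffOn ℝ ∞ K U) (hU : IsOpen U) (v w : V) :
    ContDiffOn ℝ ∞ (coneExtension Q K v w) (Q.cone U) := by
  intro y hy
  have h₁ := Q.contDiffAt_retract hy.1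
  have h₂ : ContDiffAt ℝ ∞ (fun y => K (Q.retract y)) y :=
    (hK.contDiffAt (hU.mem_nhds hy.2)).comp y h₁
  have h₃ := fun v => (Q.contDiff_radialProj v).contDiffAt.comp y h₁
  exact (((Q.contDiffAt_radius hy.1).pow 2).mul
    ((h₂.clm_apply (h₃ v)).clm_apply (h₃ w))).contDiffWithinAt

theorem IsKillingTensor.coneExtension_comm (hK : IsKillingTensor Q U K) (v w : V) :
    Set.EqOn (coneExtension Q K v w) (coneExtension Q K w v) (Q.cone U) := by
  intro y hy
  have hp := Q.retract_mem_patch hy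
  rw [coneExtension, hK.symm _ hp _ (Q.radialProj_mem_tangent hp.2 v) _
    (Q.radialProj_mem_tangent hp.2 w), coneExtension]

theorem dirDeriv_coneExtension_euler (hK : ContDiffOn ℝ ∞ K U) (hU : IsOpen U) {y : V}
    (hy : y ∈ Q.cone U) (v w : V) :
    dirDeriv y (coneExtension Q K v w) y = 2 * coneExtension Q K v w y := by
  have hd := differentiableAt_of_contDiffOn (Q.isOpen_cone hU)
    (contDiffOn_coneExtension hK hU v w) hy
  have hl : HasDerivAt (fun t : ℝ => t • y) y 1 := by
    simpa using (hasDerivAt_id (1 : ℝ)).smul_const y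
  have hd' : HasFDerivAt (coneExtension Q K v w) (fderiv ℝ (coneExtension Q K v w) y)
      ((1 : ℝ) • y) := by rw [one_smul]; exact hd.hasFDerivAt
  have h₁ := hd'.comp_hasDerivAt (1 : ℝ) hl
  have h₂ : HasDerivAt (fun t : ℝ => t ^ 2 * coneExtension Q K v w y)
      (2 * coneExtension Q K v w y) 1 := by
    simpa using (hasDerivAt_pow 2 (1 : ℝ)).mul_const (coneExtension Q K v w y)
  refine h₁.unique (h₂.congr_of_eventuallyEq ?_)
  filter_upwards [lt_mem_nhds (zero_lt_one (α := ℝ))] with t ht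
  exact coneExtension_smul_point ht v w y

/-- First derivatives are homogeneous of degree one, so the Killing equation on the cone need only
be checked at points of M. -/
theorem dirDeriv_coneExtension_smul (hK : ContDiffOn ℝ ∞ K U) (hU : IsOpen U) {t : ℝ} (ht : 0 < t)
    {x : V} (hx : x ∈ Q.patch U) (a v w : V) :
    dirDeriv a (coneExtension Q K v w) (t • x) = t * dirDeriv a (coneExtension Q K v w) x := by
  have hd := fun y hy => differentiableAt_of_contDiffOn (y := y) (Q.isOpen_cone hU)
    (contDiffOn_coneExtension hK hU v w) hy
  have hl : HasFDerivAt (fun y : V => t • y) (t • ContinuousLinearMap.id ℝ V) x :=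
    (hasFDerivAt_id x).const_smul t
  have h₁ := ((hd _ (Q.smul_mem_cone ht hx)).hasFDerivAt.comp x hl).fderiv
  have h₂ : (coneExtension Q K v w) ∘ (fun y : V => t • y)
      = fun y => t ^ 2 * coneExtension Q K v w y :=
    funext fun y => coneExtension_smul_point ht v w y
  rw [h₂, fderiv_const_mul (hd x (Q.mem_cone hx))] at h₁
  have h₃ := congrArg (fun L => L a) h₁
  simp at h₃
  simp only [dirDeriv]
  have : t * fderiv ℝ (coneExtension Q K v w) (t • x) a
      = t * (t * fderiv ℝ (coneExtension Q K v w) x a) := by rw [← h₃]; ring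
  exact mul_left_cancel₀ ht.ne' this

theorem IsKillingTensor.dirDeriv_coneExtension_tangent (hK : IsKillingTensor Q U K)
    (hU : IsOpen U) {x : V} (hx : x ∈ Q.patch U) {w : V} (hw : w ∈ Q.tangent x) :
    dirDeriv w (coneExtension Q K w w) x = 0 := by
  have hX : IsVectorField Q U (fun y => Q.radialProj y w) :=
    ⟨(Q.contDiff_radialProj w).contDiffOn, fun y hy => Q.radialProj_mem_tangent hy.2 w⟩
  have hKx := differentiableAt_of_contDiffOn hU hK.smooth hx.1
  have hXd : DifferentiableAt ℝ (fun y => Q.radialProj y w) x :=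
    (Q.contDiff_radialProj w).differentiable (by simp) x
  have hself : Q.radialProj x w = w := Q.radialProj_eq_self hw
  -- The chosen extension of w has no covariant derivative along itself at x: its flat derivative is
  -- a multiple of the normal on the sphere and zero on the hyperplane. The Killing equation thus
  -- reduces to the derivative of K(X,X).
  have hlc : leviCivita Q (fun y => Q.radialProj y w) (fun y => Q.radialProj y w) x = 0 := by
    have hn : DifferentiableAt ℝ Q.normal x := (Q.contDiff_normal.differentiable (by simp)) x
    have h1 : HasFDerivAt (fun y => w - g.formL (Q.normal y) w • y) _ x :=
      (hasFDerivAt_const w x).sub (((g.formL.hasFDerivAt.comp x hn.hasFDerivAt).clm_apply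
        (hasFDerivAt_const w x)).smul (hasFDerivAt_id x))
    have hw' := hw
    rw [Model.mem_tangent_iff] at hw'
    have h2 : fderiv ℝ (fun y => Q.radialProj y w) x w
        = -(g.form (fderiv ℝ Q.normal x w) w • x) := by
      change fderiv ℝ (fun y => w - g.formL (Q.normal y) w • y) x w = _
      rw [h1.fderiv]
      simp [hw']
    rw [leviCivita, hself, h2]
    rcases Q.fderiv_normal_cases x with ⟨hn, -, -⟩ | ⟨hn, -⟩
    · have := Q.form_normal_self hx.2
      rw [hn] at this
      simp [Model.proj, hn, this]
    · simp [hn, Model.proj]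
  have hkill := hK.killing (fun _ => fun y => Q.radialProj y w) (fun _ => hX) x hx
  rw [Finset.sum_const, covDeriv, hlc] at hkill
  simp only [map_zero, zero_apply, sub_zero, hself] at hkill
  rw [smul_eq_zero_iff_right (by simp [Fintype.card_perm, Nat.factorial])] at hkill
  rw [dirDeriv, ← hkill]
  refine Q.fderiv_eq_of_eqOn hU hx hw (differentiableAt_of_contDiffOn (Q.isOpen_cone hU)
    (contDiffOn_coneExtension hK.smooth hU w w) (Q.mem_cone hx))
    ((hKx.clm_apply hXd).clm_apply hXd) fun y hy => ?_
  rw [coneExtension, Q.radius_eq_one hy.2, Q.retract_eq_self hy.2, one_pow, one_mul]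

/-- Put v = w + c·x with w tangent, and let f be the extension. The coefficient of c is D_x f(w,w) +
2D_w f(x,w) = 2f(w,w) − 2f(w,w); degree two is exactly what makes it cancel. Higher powers of c
vanish since f(x,·) = 0 at x. -/
theorem IsKillingTensor.dirDeriv_coneExtension (hK : IsKillingTensor Q U K)
    (hU : IsOpen U) {y : V} (hy : y ∈ Q.cone U) (v : V) :
    dirDeriv v (coneExtension Q K v v) y = 0 := by
  have hx := Q.retract_mem_patch hy
  rw [← Q.radius_smul_retract hy.1, dirDeriv_coneExtension_smul hK.smooth hU (Q.radius_pos hy.1) hx]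
  generalize Q.retract y = x at hx
  have hC := Q.isOpen_cone hU
  have hxc := Q.mem_cone hx
  have hf := fun v w => contDiffOn_coneExtension (Q := Q) hK.smooth hU v w
  obtain ⟨w, c, hw, rfl⟩ : ∃ (w : V) (c : ℝ), w ∈ Q.tangent x ∧ v = w + c • x :=
    ⟨_, g.form (Q.normal x) v, Q.sub_smul_mem_tangent hx.2 v, by simp⟩
  have symm := fun a v w => dirDeriv_congr hC (hK.coneExtension_comm v w) a hxc
  have add : ∀ a v v' w, dirDeriv a (coneExtension Q K (v + v') w) x
      = dirDeriv a (coneExtension Q K v w) x + dirDeriv a (coneExtension Q K v' w) x :=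
    fun a v v' w => ((dirDeriv_congr hC (fun y _ => coneExtension_add v v' w y) a).trans
      (dirDeriv_add hC (hf v w) (hf v' w) a)) hxc
  have smul : ∀ a (r : ℝ) v w, dirDeriv a (coneExtension Q K (r • v) w) x
      = r * dirDeriv a (coneExtension Q K v w) x :=
    fun a r v w => ((dirDeriv_congr hC (fun y _ => coneExtension_smul r v w y) a).trans
      (dirDeriv_const_mul hC (hf v w) r a)) hxc
  have euler := dirDeriv_coneExtension_euler hK.smooth hU hxc
  -- This is the derivative along a of the relation f(y,w) = 0 at y, evaluated on the line x + s·a.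
  have self : ∀ a w, dirDeriv a (coneExtension Q K x w) x = -coneExtension Q K a w x := by
    intro a w
    have hl : HasDerivAt (fun s : ℝ => x + s • a) a 0 := by
      simpa using ((hasDerivAt_id (0 : ℝ)).smul_const a).const_add x
    have hd := fun v w => differentiableAt_of_contDiffOn hC (hf v w) hxc
    have hd' : ∀ v w, HasDerivAt (fun s : ℝ => coneExtension Q K v w (x + s • a))
        (dirDeriv a (coneExtension Q K v w) x) 0 := fun v w => by
      have h : HasFDerivAt (coneExtension Q K v w) (fderiv ℝ (coneExtension Q K v w) x)
          (x + (0 : ℝ) • a) := by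
        rw [zero_smul, add_zero]
        exact (hd v w).hasFDerivAt
      exact h.comp_hasDerivAt (0 : ℝ) hl
    have h₂ := ((hasDerivAt_id (0 : ℝ)).mul (hd' a w)).neg
    have h₃ : -(1 * coneExtension Q K a w (x + (0 : ℝ) • a)
        + id (0 : ℝ) * dirDeriv a (coneExtension Q K a w) x) = -coneExtension Q K a w x := by simp
    rw [← h₃]
    refine (hd' x w).unique (h₂.congr_of_eventuallyEq ?_)
    have hmem : ∀ᶠ s : ℝ in nhds 0, x + s • a ∈ Q.cone U := by
      refine hl.continuousAt.eventually_mem (hC.mem_nhds ?_)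
      simpa using hxc
    filter_upwards [hmem] with s hs
    have h₄ := coneExtension_self (K := K) hs w
    rw [coneExtension_add, coneExtension_smul] at h₄
    simp
    linarith
  have sx : ∀ w, coneExtension Q K w x x = 0 := fun w => by
    rw [hK.coneExtension_comm w x hxc, coneExtension_self hxc]
  have tang := hK.dirDeriv_coneExtension_tangent hU hx hw
  rw [add, smul, symm _ w, symm _ x, add, add, smul, smul]
  simp only [dirDeriv_add_left, dirDeriv_smul_left, tang, euler, self, sx, symm _ w x,
    coneExtension_add, coneExtension_smul, coneExtension_self hxc]
  ring

theorem IsKillingTensor.exists_correspondsS (hK : IsKillingTensor Q U K) (hU : IsOpen U)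
    (hM : (Q.patch U).Nonempty) (hc : IsPreconnected (Q.patch U)) :
    ∃ S : Tensor4 V, CorrespondsS Q U K S := by
  obtain ⟨S, hS, h⟩ := exists_symCurvature_of_killing (Q.isOpen_cone hU)
    (Q.isPreconnected_cone hc) (hM.mono fun _ => Q.mem_cone)
    (contDiffOn_coneExtension hK.smooth hU) coneExtension_add coneExtension_smul
    hK.coneExtension_comm (fun y hy v => hK.dirDeriv_coneExtension hU hy v)
    (fun y hy v w => dirDeriv_coneExtension_euler hK.smooth hU hy v w)
  refine ⟨S, hS, fun x hx v hv w hw => ?_⟩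
  rw [← h x (Q.mem_cone hx), coneExtension_of_mem hx.2 hv hw]

end KillingNijenhuis

end

/-! ### Assembly of the equivalences -/

open KillingNijenhuis
theorem mainTheorem3 {V : Type*} [NormedAddCommGroup V] [NormedSpace ℝ V] [FiniteDimensional ℝ V]
    (g : InnerProd V) (Q : Model g) (U : Set V) (hU : IsOpen U) (hM : (Q.patch U).Nonempty)
    (K : V → V →L[ℝ] V →L[ℝ] ℝ) (hK : IsKillingTensor Q U K) :
    (IsPreconnected (Q.patch U) →
      (∃! R : Tensor4 V, CorrespondsR Q U K R) ∧ (∃! S : Tensor4 V, CorrespondsS Q U K S)) ∧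
    (∀ S : Tensor4 V, CorrespondsS Q U K S →
      ∀ k : Fin 4, FirstNijenhuis Q U K ↔ act (symmetryOp k) (quadS Q S) = 0) ∧
    (∀ R : Tensor4 V, CorrespondsR Q U K R →
      (∀ k : Fin 4, FirstNijenhuis Q U K ↔ act (symmetryOp k) (quadR Q R) = 0) ∧
      (¬ Q.IsFlat →
        (FirstNijenhuis Q U K ↔ wedge (curvatureForm g R) (curvatureForm g R) = 0))) := by
  refine ⟨fun hc => ?_, fun S hS k => ?_, fun R hR => ⟨fun k => ?_, fun hflat => ?_⟩⟩
  · obtain ⟨S, hS⟩ := hK.exists_correspondsS hU hM hc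
    exact ⟨⟨toCurvature S, hS.correspondsR, fun R hR => hR.unique hU hM hS.correspondsR⟩,
      ⟨S, hS, fun S' hS' => hS'.unique hU hM hS⟩⟩
  · rw [hS.correspondsR.firstNijenhuis_iff hK.smooth hU hM, quadS_eq_symCurvQuad Q hS.1,
      act_symmetryOp_symCurvQuad_eq_zero_iff Q.gbarForm_comm (hS.1.toCurvature.isCurvatureMap g)]
  · rw [hR.firstNijenhuis_iff hK.smooth hU hM, quadR_eq_curvQuad,
      act_symmetryOp_curvQuad_eq_zero_iff Q.gbarForm_comm (hR.1.isCurvatureMap g)]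
  · cases Q with
    | hyperplane u hu => exact absurd trivial hflat
    | sphere =>
      -- On the sphere ḡ is g itself, so the wedge condition is operator (c), which has index 2 in
      -- `symmetryOp`.
      rw [hR.firstNijenhuis_iff hK.smooth hU hM, wedge_curvatureForm_eq_zero_iff g hR.1]
      exact (act_symmetryOp_curvQuad_eq_zero_iff (Model.gbarForm_comm .sphere)
        (hR.1.isCurvatureMap g) 2).symm
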